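/- **Setting.** Let $\mathcal X$ be a finite alphabet and let $\mathcal P_0,\mathcal P_1$ be non-empty closed convex sets of probability distributions on $\mathcal X$. A randomized time-invariant finite state machine (FSM) with $S\ge 1$ states consists of transition probabilities $\pi(t\mid s,x)\ge 0$ ($s,t\in[S]$, $x\in\mathcal X$) with $\sum_t\pi(t\mid s,x)=1$ and a decision function $\hat H:[S]\to\{0,1\}$; it starts in a fixed state $R_0\in[S]$. Under hypothesis $h\in\{0,1\}$ an adversary uses a strategy $\mathcal A_h=(p_n)_{n\ge1}$ with $p_n:\mathcal X^{n-1}\times[S]^n\to\mathcal P_h$: given the past samples $X_1,\dots,X_{n-1}$ and states $R_0,\dots,R_{n-1}$, the sample $X_n$ has distribution $p_n(X_1^{n-1},R_0^{n-1})$, and then $R_n\sim\pi(\cdot\mid R_{n-1},X_n)$. The minimax asymptotic error is $$P_e^*(S)=\inf_{\pi,\hat H}\ \sup_{\mathcal A_0,\mathcal A_1}\ \max_{h\in\{0,1\}}\ \limsup_{n\to\infty}\frac1n\sum_{i=1}^n\mathbb P_{H=h}^{\pi,\mathcal A_h}\big[\hat H(R_i)\ne h\big].$$ Put $$\gamma=\sup_{f_+,f_-}\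 \min_{p\in\mathcal P_0,\,q\in\mathcal P_1}\frac{\mathbb E_q[f_+]\,\mathbb E_p[f_-]}{\mathbb E_q[f_-]\,\mathbb E_p[f_+]},\qquad C=\sup_{f_+,f_-}\ \min_{p,p'\in\mathcal P_0,\ q,q'\in\mathcal P_1}\frac{\mathbb E_q[f_+]\,\mathbb E_p[f_-]}{\mathbb E_{q'}[f_-]\,\mathbb E_{p'}[f_+]},$$ where the suprema are over functions $f_+,f_-:\mathcal X\to[0,\infty)$ with $f_++f_-\le1$, and the values lie in $[0,\infty]$ with $0/0=0$, $a/0=\infty$ for $a>0$, and $1/\infty=0$. **Theorem.** For every $S\ge1$ and every initial state $R_0\in[S]$, $$P_e^*(S)\ \ge\ \frac1{1+\sqrt{\gamma^{S-1}}},$$ and, if $S\ge3$, $$P_e^*(S)\ \le\ \frac1{1+\sqrt{C\,\gamma^{S-2}}}.$$ -/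

import Mathlib

open scoped ENNReal
open Filter

namespace AdvHT

/-- A randomized time-invariant finite state machine with state space `Fin S` (the `S` states),
input alphabet `X` and output in `{0, 1}`: `trans s x t` is the probability `π(t | s, x)` of moving
to state `t` from state `s` on input `x`, and `decision` is the decision function. -/
structure FSM (X : Type*) (S : ℕ) where
  trans : Fin S → X → Fin S → ℝ
  trans_nonneg : ∀ s x t, 0 ≤ trans s x t
  trans_sum : ∀ s x, ∑ t, trans s x t = 1
  decision : Fin S → Fin 2

/-- An adversarial strategy with distributions in `P`: the distribution of sample number `n + 1` is
a function of the past samples `X_1, …, X_n` and of the past states `R_0, …, R_n`. -/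
def Strategy {X : Type*} (S : ℕ) (P : Set (X → ℝ)) : Type _ :=
  (n : ℕ) → (Fin n → X) → (Fin (n + 1) → Fin S) → P

variable {X : Type*} [Fintype X] {S : ℕ}

/-- The probability that the first `n` samples are `x` and that the states `R_0, …, R_n` are `r`,
when the machine starts in `r₀` and the adversary follows `A`. Sample number `i + 1` is `x i`, drawn
from the distribution that `A` selects from the history up to time `i`, and the machine then moves
from `r i` to `r (i + 1)`. -/
noncomputable def pathProb {P : Set (X → ℝ)} (D : FSM X S) (r₀ : Fin S) (A : Strategy S P) (n : ℕ)
    (x : Fin n → X) (r : Fin (n + 1) → Fin S) : ℝ :=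
  if r 0 = r₀ then
    ∏ i : Fin n,
      (A i (fun j => x (Fin.castLE i.isLt.le j))
          (fun j => r (Fin.castLE (Nat.succ_le_succ i.isLt.le) j)) : X → ℝ) (x i)
        * D.trans (r i.castSucc) (x i) (r i.succ)
  else 0

/-- The probability that the output at time `n` differs from `h`. -/
noncomputable def errProb {P : Set (X → ℝ)} (D : FSM X S) (r₀ : Fin S) (A : Strategy S P)
    (h : Fin 2) (n : ℕ) : ℝ :=
  ∑ x : Fin n → X, ∑ r : Fin (n + 1) → Fin S,
    if D.decision (r (Fin.last n)) ≠ h then pathProb D r₀ A n x r else 0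

/-- The time average over the times `1, …, n` of the error probability under hypothesis `h`. -/
noncomputable def avgErr {P : Set (X → ℝ)} (D : FSM X S) (r₀ : Fin S) (A : Strategy S P)
    (h : Fin 2) (n : ℕ) : ℝ :=
  (1 / (n : ℝ)) * ∑ i ∈ Finset.Icc 1 n, errProb D r₀ A h i

/-- The asymptotic error probability of the machine `D`, started in `r₀`, against a pair of
strategies, one for each hypothesis (`limsup`, since an adversary may prevent convergence). -/
noncomputable def asympErr {P : Fin 2 → Set (X → ℝ)} (D : FSM X S) (r₀ : Fin S)
    (A : (h : Fin 2) → Strategy S (P h)) : ℝ≥0∞ :=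
  ⨆ h : Fin 2, limsup (fun n : ℕ => ENNReal.ofReal (avgErr D r₀ (A h) h n)) atTop

/-- The asymptotic minimax risk of machines with `S` states and initial state `r₀`. -/
noncomputable def minimaxRisk (P : Fin 2 → Set (X → ℝ)) (S : ℕ) (r₀ : Fin S) : ℝ≥0∞ :=
  ⨅ D : FSM X S, ⨆ A : (h : Fin 2) → Strategy S (P h), asympErr D r₀ A

/-- The expectation of `f` under the distribution `p`. -/
def expect (p f : X → ℝ) : ℝ := ∑ x, p x * f x

/-- The admissible pairs `(f_+, f_-)` of weight functions. -/
def weights (X : Type*) : Set ((X → ℝ) × (X → ℝ)) :=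
  {f | ∀ x, 0 ≤ f.1 x ∧ 0 ≤ f.2 x ∧ f.1 x + f.2 x ≤ 1}

/-- The ratio `E_q[f_+] E_p[f_-] / (E_{q'}[f_-] E_{p'}[f_+])`. In `ℝ≥0∞` one has `0 / 0 = 0` and
`a / 0 = ∞` for `a ≠ 0`. -/
noncomputable def ratio (f : (X → ℝ) × (X → ℝ)) (p p' q q' : X → ℝ) : ℝ≥0∞ :=
  ENNReal.ofReal (expect q f.1 * expect p f.2) / ENNReal.ofReal (expect q' f.2 * expect p' f.1)

/-- The constant `γ`. -/
noncomputable def gammaConst (P : Fin 2 → Set (X → ℝ)) : ℝ≥0∞ :=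
  ⨆ f ∈ weights X, ⨅ p ∈ P 0, ⨅ q ∈ P 1, ratio f p p q q

/-- The constant `C`. -/
noncomputable def cConst (P : Fin 2 → Set (X → ℝ)) : ℝ≥0∞ :=
  ⨆ f ∈ weights X, ⨅ p ∈ P 0, ⨅ p' ∈ P 0, ⨅ q ∈ P 1, ⨅ q' ∈ P 1, ratio f p p' q q'

end AdvHT

/-!
Lower bound. Suppose `γ < ∞`. A separating hyperplane gives `p ∈ P 0`, `q ∈ P 1` and `c` with
`p ≤ c q ≤ γ p` pointwise (`exists_comparable`), and both adversaries simply draw independent samples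
from `p` and `q`. The states then form Markov chains with kernels `K` and `L` such that
`K ≤ c L ≤ γ K`. Let `μ` and `ν` be stationary distributions, and sort the states by the likelihood
ratio `ν / μ`. Across each cut of this order the stationary flow up equals the flow down, under both
kernels, so consecutive values of `ν / μ` differ by a factor of at most `γ`, and all of them by at
most `γ ^ (S - 1)` (`stationary_ratio_le`). Summation over the states with decisions `1` and `0`
gives `(1 - e₀) (1 - e₁) ≤ γ ^ (S - 1) e₀ e₁` for the two error probabilities, hence the bound. The
chains need not be irreducible, so the argument is run for the chain that restarts in `r₀` with
probability `ε`. Its stationary distribution is the Abel mean of the laws of the original chain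
(`abelLaw_stationary`), and a bound on the time averages bounds the Abel means as `ε → 0`
(`abel_le_of_sum_le`).

Upper bound. The machine is a birth-death chain on `0, …, m + 1` with `m = S - 2` (`walk`). In the
inner states it moves by weights that are good for `γ`, in the two end states by weights that are
good for `C`, slowed down so that nearly all the time is spent at the ends. Under the hypothesis `1`
the odds of `0` against `m + 1` are at most `κ₁`, and under `0` those of `m + 1` against `0` are at
most `κ₀`, where `κ₀ κ₁` is about `1 / (C γ ^ m)`; the ratio of the rates at the two ends balances
them (`exists_rates`). Against an adaptive adversary no stationary distribution is available. In its
place a potential function certifies the error: its expected increment, in each state and under each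
admissible distribution, is at most the bound minus the cost (`exists_potential`,
`limsup_avgErr_le`).
-/

namespace AdvHT

variable {X : Type*} {S : ℕ}

/-! ### The law of the state and the drift criterion -/

lemma pathProb_snoc {P : Set (X → ℝ)} (D : FSM X S) (r₀ : Fin S) (A : Strategy S P) (n : ℕ)
    (x : Fin n → X) (r : Fin (n + 1) → Fin S) (y : X) (t : Fin S) :
    pathProb D r₀ A (n + 1) (Fin.snoc x y : Fin (n + 1) → X)
      (Fin.snoc r t : Fin (n + 2) → Fin S) =
      pathProb D r₀ A n x r * ((A n x r : X → ℝ) y * D.trans (r (Fin.last n)) y t) := by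
  have hx : ∀ (k : ℕ) (hk : k ≤ n) (j : Fin k),
      (Fin.snoc x y : Fin (n + 1) → X) (Fin.castLE (hk.trans n.le_succ) j) = x (Fin.castLE hk j) :=
    fun k hk j => Fin.snoc_castSucc (α := fun _ => X) y x (Fin.castLE hk j)
  have hr : ∀ (k : ℕ) (hk : k ≤ n + 1) (j : Fin k),
      (Fin.snoc r t : Fin (n + 2) → Fin S) (Fin.castLE (hk.trans (n + 1).le_succ) j) =
        r (Fin.castLE hk j) :=
    fun k hk j => Fin.snoc_castSucc (α := fun _ => Fin S) t r (Fin.castLE hk j)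
  have h0 : (Fin.snoc r t : Fin (n + 2) → Fin S) 0 = r 0 :=
    Fin.snoc_castSucc (α := fun _ => Fin S) t r 0
  unfold pathProb
  rw [h0]
  split_ifs with h
  · rw [Fin.prod_univ_castSucc]
    congr 1
    · refine Finset.prod_congr rfl fun i _ => ?_
      rw [Fin.snoc_castSucc, Fin.snoc_castSucc, ← Fin.castSucc_succ, Fin.snoc_castSucc]
      congr 1
      exact congrArg₂ (fun a b => (A i a b : X → ℝ) (x i)) (funext fun j => hx i i.isLt.le j)
        (funext fun j => hr (i + 1) (Nat.succ_le_succ i.isLt.le) j)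
    · rw [Fin.snoc_last, Fin.snoc_castSucc, Fin.succ_last, Fin.snoc_last]
      congr 1
      exact congrArg₂ (fun a b => (A n a b : X → ℝ) y) (funext fun j => hx n le_rfl j)
        (funext fun j => hr (n + 1) le_rfl j)
  · simp

variable [Fintype X]

/-- The expectation of `V (R_n)` when the machine starts in `r₀` against the strategy `A`. -/
noncomputable def stateExp {P : Set (X → ℝ)} (D : FSM X S) (r₀ : Fin S) (A : Strategy S P) (n : ℕ)
    (V : Fin S → ℝ) : ℝ :=
  ∑ x : Fin n → X, ∑ r : Fin (n + 1) → Fin S, pathProb D r₀ A n x r * V (r (Fin.last n))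

/-- The expectation of `V` after one step from the state `s` on a sample with distribution `p`. -/
def stepExp (D : FSM X S) (p : X → ℝ) (s : Fin S) (V : Fin S → ℝ) : ℝ :=
  ∑ y, p y * ∑ t, D.trans s y t * V t

lemma errProb_eq_stateExp {P : Set (X → ℝ)} (D : FSM X S) (r₀ : Fin S) (A : Strategy S P)
    (h : Fin 2) (n : ℕ) :
    errProb D r₀ A h n = stateExp D r₀ A n (fun s => if D.decision s ≠ h then 1 else 0) := by
  simp only [errProb, stateExp, mul_ite, mul_one, mul_zero]

lemma pathProb_nonneg {P : Set (X → ℝ)} (hP : P ⊆ stdSimplex ℝ X) (D : FSM X S) (r₀ : Fin S)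
    (A : Strategy S P) (n : ℕ) (x : Fin n → X) (r : Fin (n + 1) → Fin S) :
    0 ≤ pathProb D r₀ A n x r := by
  unfold pathProb
  split_ifs
  · exact Finset.prod_nonneg fun i _ =>
      mul_nonneg ((hP (Subtype.coe_prop _)).1 _) (D.trans_nonneg _ _ _)
  · exact le_rfl

lemma stateExp_zero {P : Set (X → ℝ)} (D : FSM X S) (r₀ : Fin S) (A : Strategy S P)
    (V : Fin S → ℝ) : stateExp D r₀ A 0 V = V r₀ := by
  unfold stateExp pathProb
  rw [Fintype.sum_unique]
  rw [← (Equiv.funUnique (Fin 1) (Fin S)).symm.sum_comp]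
  simp

lemma stateExp_succ {P : Set (X → ℝ)} (D : FSM X S) (r₀ : Fin S) (A : Strategy S P) (n : ℕ)
    (V : Fin S → ℝ) :
    stateExp D r₀ A (n + 1) V = ∑ x : Fin n → X, ∑ r : Fin (n + 1) → Fin S,
      pathProb D r₀ A n x r * stepExp D (A n x r) (r (Fin.last n)) V := by
  unfold stateExp stepExp
  rw [← (Fin.snocEquiv fun _ : Fin (n + 1) => X).sum_comp, Fintype.sum_prod_type,
    Finset.sum_comm]
  refine Finset.sum_congr rfl fun x _ => ?_
  simp_rw [Finset.mul_sum]
  rw [Finset.sum_comm' (t' := Finset.univ) (s' := fun _ => Finset.univ) (by simp)]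
  rw [← (Fin.snocEquiv fun _ : Fin (n + 2) => Fin S).sum_comp, Fintype.sum_prod_type,
    Finset.sum_comm]
  refine Finset.sum_congr rfl fun r _ => ?_
  rw [Finset.sum_comm]
  refine Finset.sum_congr rfl fun y _ => Finset.sum_congr rfl fun t _ => ?_
  have h1 : (Fin.snocEquiv fun _ : Fin (n + 1) => X) (y, x) = Fin.snoc x y := rfl
  have h2 : (Fin.snocEquiv fun _ : Fin (n + 2) => Fin S) (t, r) = Fin.snoc r t := rfl
  rw [h1, h2, pathProb_snoc, Fin.snoc_last]
  ring

lemma stepExp_const {p : X → ℝ} (hp : p ∈ stdSimplex ℝ X) (D : FSM X S) (s : Fin S) (a : ℝ) :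
    stepExp D p s (fun _ => a) = a := by
  simp [stepExp, ← Finset.sum_mul, D.trans_sum, hp.2]

lemma stateExp_mono {P : Set (X → ℝ)} (hP : P ⊆ stdSimplex ℝ X) (D : FSM X S) (r₀ : Fin S)
    (A : Strategy S P) (n : ℕ) {V W : Fin S → ℝ} (h : ∀ s, V s ≤ W s) :
    stateExp D r₀ A n V ≤ stateExp D r₀ A n W :=
  Finset.sum_le_sum fun x _ => Finset.sum_le_sum fun r _ =>
    mul_le_mul_of_nonneg_left (h _) (pathProb_nonneg hP D r₀ A n x r)

lemma stateExp_const {P : Set (X → ℝ)} (hP : P ⊆ stdSimplex ℝ X) (D : FSM X S) (r₀ : Fin S)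
    (A : Strategy S P) (n : ℕ) (a : ℝ) : stateExp D r₀ A n (fun _ => a) = a := by
  induction n with
  | zero => exact stateExp_zero D r₀ A _
  | succ n ih =>
    rw [stateExp_succ, ← ih]
    refine Finset.sum_congr rfl fun x _ => Finset.sum_congr rfl fun r _ => ?_
    rw [stepExp_const (hP (Subtype.coe_prop _)), ih]

/-- A drift inequality that holds in every state and against every admissible distribution survives
adaptive play, since the strategy only chooses a distribution for each history. -/
lemma stateExp_succ_le {P : Set (X → ℝ)} (hP : P ⊆ stdSimplex ℝ X) (D : FSM X S) (r₀ : Fin S)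
    (A : Strategy S P) {V c : Fin S → ℝ} {e : ℝ}
    (h : ∀ s, ∀ p ∈ P, stepExp D p s V ≤ V s + e - c s) (n : ℕ) :
    stateExp D r₀ A (n + 1) V ≤ stateExp D r₀ A n V + e - stateExp D r₀ A n c := by
  have h1 : stateExp D r₀ A n V + e - stateExp D r₀ A n c =
      stateExp D r₀ A n (fun s => V s + e - c s) := by
    conv_lhs => rw [← stateExp_const hP D r₀ A n e]
    simp only [stateExp, ← Finset.sum_add_distrib, ← Finset.sum_sub_distrib]
    exact Finset.sum_congr rfl fun x _ => Finset.sum_congr rfl fun r _ => by ring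
  rw [h1, stateExp_succ]
  exact Finset.sum_le_sum fun x _ => Finset.sum_le_sum fun r _ =>
    mul_le_mul_of_nonneg_left (h _ _ (Subtype.coe_prop _)) (pathProb_nonneg hP D r₀ A n x r)

lemma errProb_mem_Icc {P : Set (X → ℝ)} (hP : P ⊆ stdSimplex ℝ X) (D : FSM X S) (r₀ : Fin S)
    (A : Strategy S P) (h : Fin 2) (n : ℕ) : errProb D r₀ A h n ∈ Set.Icc (0 : ℝ) 1 := by
  rw [errProb_eq_stateExp]
  constructor
  · conv_lhs => rw [← stateExp_const hP D r₀ A n 0]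
    exact stateExp_mono hP D r₀ A n fun s => by split_ifs <;> norm_num
  · conv_rhs => rw [← stateExp_const hP D r₀ A n 1]
    exact stateExp_mono hP D r₀ A n fun s => by split_ifs <;> norm_num

/-- The verification principle: a potential `V` whose drift is at most `e` minus the error indicator
certifies the asymptotic error `e` against every adaptive strategy. -/
lemma limsup_avgErr_le {P : Set (X → ℝ)} (hP : P ⊆ stdSimplex ℝ X) (D : FSM X S) (r₀ : Fin S)
    (A : Strategy S P) (h : Fin 2) {V : Fin S → ℝ} {e : ℝ}
    (hV : ∀ s, ∀ p ∈ P, stepExp D p s V ≤ V s + e - if D.decision s ≠ h then 1 else 0) :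
    limsup (fun n : ℕ => ENNReal.ofReal (avgErr D r₀ A h n)) atTop ≤ ENNReal.ofReal e := by
  obtain ⟨B, hB⟩ : ∃ B : ℝ, ∀ s, |V s| ≤ B :=
    ⟨∑ s, |V s|, fun s => Finset.single_le_sum (fun i _ => abs_nonneg (V i)) (Finset.mem_univ s)⟩
  have hsum : ∀ n, ∑ i ∈ Finset.range n, errProb D r₀ A h i ≤ n * e + 2 * B := by
    have key : ∀ n, ∑ i ∈ Finset.range n, errProb D r₀ A h i ≤
        n * e + V r₀ - stateExp D r₀ A n V := by
      intro n
      induction n with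
      | zero => simp [stateExp_zero]
      | succ n ih =>
        rw [Finset.sum_range_succ]
        have := stateExp_succ_le hP D r₀ A hV n
        rw [← errProb_eq_stateExp] at this
        push_cast
        linarith
    intro n
    have h1 : -B ≤ stateExp D r₀ A n V := by
      rw [← stateExp_const hP D r₀ A n (-B)]
      exact stateExp_mono hP D r₀ A n fun s => (abs_le.1 (hB s)).1
    linarith [key n, (abs_le.1 (hB r₀)).2]
  have hlim : Tendsto (fun n : ℕ => ENNReal.ofReal (e + (2 * B + 1) * (1 / (n : ℝ)))) atTop
      (nhds (ENNReal.ofReal e)) := by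
    refine ENNReal.tendsto_ofReal ?_
    simpa using (tendsto_one_div_atTop_nhds_zero_nat.const_mul (2 * B + 1)).const_add e
  rw [← hlim.limsup_eq]
  refine limsup_le_limsup ?_
  filter_upwards [eventually_gt_atTop 0] with n hn
  refine ENNReal.ofReal_le_ofReal ?_
  have hn' : (0 : ℝ) < n := by exact_mod_cast hn
  have h2 : ∑ i ∈ Finset.Icc 1 n, errProb D r₀ A h i ≤ n * e + (2 * B + 1) := by
    have h3 : ∑ i ∈ Finset.Icc 1 n, errProb D r₀ A h i ≤
        ∑ i ∈ Finset.range (n + 1), errProb D r₀ A h i := by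
      refine Finset.sum_le_sum_of_subset_of_nonneg ?_ fun i _ _ => (errProb_mem_Icc hP D r₀ A h i).1
      intro i hi
      simp only [Finset.mem_Icc, Finset.mem_range] at *
      omega
    rw [Finset.sum_range_succ] at h3
    linarith [hsum n, (errProb_mem_Icc hP D r₀ A h n).2]
  unfold avgErr
  calc 1 / (n : ℝ) * ∑ i ∈ Finset.Icc 1 n, errProb D r₀ A h i
      ≤ 1 / (n : ℝ) * (n * e + (2 * B + 1)) := by gcongr
    _ = e + (2 * B + 1) * (1 / (n : ℝ)) := by field_simp

/-! ### Stationary distributions of comparable Markov kernels -/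

section Stationary

variable {σ : Type*} [Fintype σ]

/-- If every state of a kernel `K` jumps to `r₀` with positive probability, then a stationary
distribution of `K` carries no mass outside a set that contains `r₀` and is closed under `K`: the
mass outside leaks into the set and never returns. -/
lemma eq_zero_of_stationary {K : σ → σ → ℝ} (hK : ∀ s t, 0 ≤ K s t) (hK1 : ∀ s, ∑ t, K s t = 1)
    {ν : σ → ℝ} (hν : ∀ s, 0 ≤ ν s) (hst : ∀ t, ∑ s, ν s * K s t = ν t) {r₀ : σ}
    (hr : ∀ s, 0 < K s r₀) {U : Set σ} (hU : r₀ ∈ U) (hcl : ∀ s ∈ U, ∀ t ∉ U, K s t = 0)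
    {s : σ} (hs : s ∉ U) : ν s = 0 := by
  classical
  -- the mass of the complement is what stays there in one step
  have h1 : ∑ t with t ∉ U, ν t = ∑ s with s ∉ U, ν s * ∑ t with t ∉ U, K s t := by
    calc ∑ t with t ∉ U, ν t = ∑ t with t ∉ U, ∑ s, ν s * K s t :=
          Finset.sum_congr rfl fun t _ => (hst t).symm
      _ = ∑ s, ∑ t with t ∉ U, ν s * K s t := Finset.sum_comm
      _ = ∑ s with s ∉ U, ∑ t with t ∉ U, ν s * K s t := by
          refine (Finset.sum_subset (Finset.subset_univ _) fun s _ hs => ?_).symm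
          refine Finset.sum_eq_zero fun t ht => ?_
          rw [hcl s (by simpa using hs) t (by simpa using ht), mul_zero]
      _ = _ := by simp_rw [Finset.mul_sum]
  have h2 : ∑ s with s ∉ U, ν s * (1 - ∑ t with t ∉ U, K s t) = 0 := by
    simp_rw [mul_sub, mul_one, Finset.sum_sub_distrib]
    linarith
  have h3 : ∀ s, 0 < 1 - ∑ t with t ∉ U, K s t := by
    intro s
    have h4 : K s r₀ + ∑ t with t ∉ U, K s t ≤ 1 := by
      rw [← hK1 s, ← Finset.sum_insert (by simpa using hU)]
      exact Finset.sum_le_sum_of_subset_of_nonneg (Finset.subset_univ _) fun t _ _ => hK s t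
    linarith [hr s]
  have h5 := (Finset.sum_eq_zero_iff_of_nonneg fun s _ => mul_nonneg (hν s) (h3 s).le).1 h2 s
    (by simpa using hs)
  exact (mul_eq_zero.1 h5).resolve_right (h3 s).ne'

/-- Of two kernels such that transitions of the second are possible in the first, the support of a
stationary distribution of the first contains that of the second. -/
lemma pos_of_stationary_pos {K L : σ → σ → ℝ} (hK : ∀ s t, 0 ≤ K s t)
    (hL : ∀ s t, 0 ≤ L s t) (hL1 : ∀ s, ∑ t, L s t = 1)
    {μ ν : σ → ℝ} (hμ : ∀ s, 0 ≤ μ s) (hμ1 : ∑ s, μ s = 1) (hν : ∀ s, 0 ≤ ν s)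
    (hμst : ∀ t, ∑ s, μ s * K s t = μ t) (hνst : ∀ t, ∑ s, ν s * L s t = ν t)
    (hKL : ∀ s t, K s t = 0 → L s t = 0) {r₀ : σ} (hrK : ∀ s, 0 < K s r₀)
    (hrL : ∀ s, 0 < L s r₀) {s : σ} (hs : 0 < ν s) : 0 < μ s := by
  by_contra hcon
  have hpos : ∀ s t, 0 < μ s → 0 < K s t → 0 < μ t := fun s t h1 h2 => by
    rw [← hμst t]
    exact (mul_pos h1 h2).trans_le
      (Finset.single_le_sum (f := fun s => μ s * K s t)
        (fun i _ => mul_nonneg (hμ i) (hK i t)) (Finset.mem_univ s))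
  obtain ⟨s₁, hs₁⟩ : ∃ s, 0 < μ s := by
    by_contra! h
    have := Finset.sum_nonpos fun s (_ : s ∈ Finset.univ) => h s
    linarith
  refine hs.ne' (eq_zero_of_stationary hL hL1 hν hνst hrL (U := {s | 0 < μ s})
    (hpos s₁ r₀ hs₁ (hrK s₁)) (fun s hs t ht => hKL s t ?_) hcon)
  by_contra h
  exact ht (hpos s t hs (lt_of_le_of_ne (hK s t) (Ne.symm h)))

/-- The stationary flow out of a set equals the flow into it. -/
lemma flow_balance {K : σ → σ → ℝ} (hK1 : ∀ s, ∑ t, K s t = 1) {μ : σ → ℝ}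
    (hst : ∀ t, ∑ s, μ s * K s t = μ t) (q : σ → Prop) [DecidablePred q] :
    ∑ s with q s, ∑ t with ¬ q t, μ s * K s t = ∑ s with ¬ q s, ∑ t with q t, μ s * K s t := by
  have h1 : ∑ s with q s, ∑ t, μ s * K s t = ∑ s with q s, μ s :=
    Finset.sum_congr rfl fun s _ => by rw [← Finset.mul_sum, hK1, mul_one]
  have h2 : ∑ t with q t, ∑ s, μ s * K s t = ∑ s with q s, μ s :=
    Finset.sum_congr rfl fun s _ => hst s
  rw [Finset.sum_comm] at h2
  have h3 : ∑ s with q s, ∑ t, μ s * K s t =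
      ∑ s with q s, ∑ t with q t, μ s * K s t + ∑ s with q s, ∑ t with ¬ q t, μ s * K s t := by
    rw [← Finset.sum_add_distrib]
    exact Finset.sum_congr rfl fun s _ => (Finset.sum_filter_add_sum_filter_not _ _ _).symm
  have h4 := Finset.sum_filter_add_sum_filter_not Finset.univ q
    fun s => ∑ t with q t, μ s * K s t
  linarith

/-- In a finite set of at most `n + 1` reals in which every non-maximal element `a` is followed by
some element in `(a, G * a]`, any two elements differ by a factor of at most `G ^ n`. -/
lemma le_pow_mul_of_gaps {G : ℝ} (hG : 1 ≤ G) (n : ℕ) :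
    ∀ V : Finset ℝ, (∀ a ∈ V, 0 < a) → V.card ≤ n + 1 →
      (∀ a ∈ V, ∀ b ∈ V, a < b → ∃ b' ∈ V, a < b' ∧ b' ≤ G * a) →
      ∀ a ∈ V, ∀ b ∈ V, b ≤ G ^ n * a := by
  induction n with
  | zero =>
    intro V hpos hc h a ha b hb
    rw [Finset.card_le_one.1 hc b hb a ha]
    simp
  | succ n ih =>
    intro V hpos hc h a ha b hb
    rcases lt_or_ge a b with hab | hab
    · obtain ⟨b', hb', hab', hle⟩ := h a ha b hb hab
      have hlt : (V.filter (a < ·)).card < V.card :=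
        Finset.card_lt_card (Finset.filter_ssubset.2 ⟨a, ha, lt_irrefl a⟩)
      have := ih (V.filter (a < ·)) (fun c hc => hpos c (Finset.mem_filter.1 hc).1) (by omega)
        (fun c hc d hd hcd => by
          obtain ⟨hcV, hac⟩ := Finset.mem_filter.1 hc
          obtain ⟨e, he, hce, hle⟩ := h c hcV d (Finset.mem_filter.1 hd).1 hcd
          exact ⟨e, Finset.mem_filter.2 ⟨he, hac.trans hce⟩, hce, hle⟩)
        b' (Finset.mem_filter.2 ⟨hb', hab'⟩) b (Finset.mem_filter.2 ⟨hb, hab⟩)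
      calc b ≤ G ^ n * b' := this
        _ ≤ G ^ n * (G * a) := by gcongr
        _ = G ^ (n + 1) * a := by ring
    · calc b ≤ 1 * a := by simpa using hab
        _ ≤ G ^ (n + 1) * a := by
          have := (hpos a ha).le
          gcongr
          exact one_le_pow₀ hG

/-- The spread of the likelihood ratio of the stationary distributions of two kernels that are
comparable up to the factor `G`: sort the states by likelihood ratio and compare, under both kernels,
the flow across a cut with the flow back. -/
lemma stationary_ratio_le {K L : σ → σ → ℝ} (hK : ∀ s t, 0 ≤ K s t) (hL : ∀ s t, 0 ≤ L s t)
    (hK1 : ∀ s, ∑ t, K s t = 1) (hL1 : ∀ s, ∑ t, L s t = 1) {c G : ℝ} (hc : 0 < c)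
    (hG : 1 ≤ G) (hKL : ∀ s t, K s t ≤ c * L s t) (hLK : ∀ s t, c * L s t ≤ G * K s t)
    {μ ν : σ → ℝ} (hμ : ∀ s, 0 ≤ μ s) (hν : ∀ s, 0 ≤ ν s) (hμ1 : ∑ s, μ s = 1)
    (hν1 : ∑ s, ν s = 1) (hμst : ∀ t, ∑ s, μ s * K s t = μ t)
    (hνst : ∀ t, ∑ s, ν s * L s t = ν t) {r₀ : σ} (hr : ∀ s, 0 < K s r₀) (s t : σ) :
    ν s * μ t ≤ G ^ (Fintype.card σ - 1) * (μ s * ν t) := by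
  classical
  have hG0 : 0 < G := by linarith
  have hrL : ∀ s, 0 < L s r₀ := fun s => by
    have := (hr s).trans_le (hKL s r₀)
    exact (mul_pos_iff_of_pos_left hc).1 this
  have hμν : ∀ s, 0 < ν s → 0 < μ s := fun s =>
    pos_of_stationary_pos hK hL hL1 hμ hμ1 hν hμst hνst (fun s t h => by
      have h1 := hLK s t
      rw [h, mul_zero] at h1
      exact le_antisymm (nonpos_of_mul_nonpos_right h1 hc) (hL s t)) hr hrL
  have hνμ : ∀ s, 0 < μ s → 0 < ν s := fun s =>
    pos_of_stationary_pos hL hK hK1 hν hν1 hμ hνst hμst (fun s t h => by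
      have h1 := hKL s t
      rw [h, mul_zero] at h1
      exact le_antisymm h1 (hK s t)) hrL hr
  set ρ : σ → ℝ := fun s => ν s / μ s with hρ
  set T : Finset σ := Finset.univ.filter fun s => 0 < μ s with hT
  have hρν : ∀ s, ν s = ρ s * μ s := by
    intro s
    rcases (hμ s).eq_or_lt with h | h
    · rw [← h, mul_zero]
      by_contra h2
      have := hμν s (lt_of_le_of_ne (hν s) (Ne.symm h2))
      linarith
    · rw [hρ]
      field_simp
  have hmemT : ∀ s, s ∈ T ↔ 0 < μ s := fun s => by simp [hT]
  have hgap : ∀ a ∈ T.image ρ, ∀ b ∈ T.image ρ, a < b → ∃ b' ∈ T.image ρ, a < b' ∧ b' ≤ G * a := by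
    intro a ha b hb hab
    have hne : ((T.image ρ).filter (a < ·)).Nonempty := ⟨b, Finset.mem_filter.2 ⟨hb, hab⟩⟩
    obtain ⟨b', hb', hmin⟩ := Finset.exists_min_image _ id hne
    obtain ⟨hb'V, hab'⟩ := Finset.mem_filter.1 hb'
    refine ⟨b', hb'V, hab', ?_⟩
    obtain ⟨s₁, hs₁T, hs₁⟩ := Finset.mem_image.1 ha
    obtain ⟨s₂, hs₂T, hs₂⟩ := Finset.mem_image.1 hb'V
    have hμs₁ := (hmemT s₁).1 hs₁T
    have hμs₂ := (hmemT s₂).1 hs₂T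
    have ha0 : 0 < a := by rw [← hs₁]; exact div_pos (hνμ _ hμs₁) hμs₁
    have hb0 : 0 < b' := ha0.trans hab'
    have hbK := flow_balance hK1 hμst (fun s => ρ s ≤ a)
    have hbL := flow_balance hL1 hνst (fun s => ρ s ≤ a)
    set F := ∑ s with ρ s ≤ a, ∑ t with ¬ ρ t ≤ a, μ s * K s t with hF
    have hup : c * ∑ s with ρ s ≤ a, ∑ t with ¬ ρ t ≤ a, ν s * L s t ≤ a * (G * F) := by
      rw [hF]
      simp only [Finset.mul_sum]
      refine Finset.sum_le_sum fun s hs => Finset.sum_le_sum fun t _ => ?_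
      have hs' : ρ s ≤ a := (Finset.mem_filter.1 hs).2
      rw [hρν s]
      calc c * (ρ s * μ s * L s t) = (ρ s * μ s) * (c * L s t) := by ring
        _ ≤ (a * μ s) * (G * K s t) :=
          mul_le_mul (mul_le_mul_of_nonneg_right hs' (hμ s)) (hLK s t)
            (mul_nonneg hc.le (hL s t)) (mul_nonneg ha0.le (hμ s))
        _ = a * (G * (μ s * K s t)) := by ring
    have hdown : b' * F ≤ c * ∑ s with ¬ ρ s ≤ a, ∑ t with ρ t ≤ a, ν s * L s t := by
      rw [hbK]
      simp only [Finset.mul_sum]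
      refine Finset.sum_le_sum fun s hs => Finset.sum_le_sum fun t _ => ?_
      rcases (hμ s).eq_or_lt with h0 | h0
      · rw [hρν s, ← h0]
        simp
      have hs' : b' ≤ ρ s := hmin (ρ s) (Finset.mem_filter.2
        ⟨Finset.mem_image_of_mem ρ ((hmemT s).2 h0), not_le.1 (Finset.mem_filter.1 hs).2⟩)
      rw [hρν s]
      calc b' * (μ s * K s t) = (b' * μ s) * K s t := by ring
        _ ≤ (ρ s * μ s) * (c * L s t) := by
          have h2 := hK s t
          gcongr
          · exact mul_nonneg (hb0.le.trans hs') h0.le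
          · exact hKL s t
        _ = c * (ρ s * μ s * L s t) := by ring
    -- the jumps to `r₀` make the flow positive, in the direction of the side that contains `r₀`
    have hFpos : 0 < F := by
      have hnn : ∀ s t, 0 ≤ μ s * K s t := fun s t => mul_nonneg (hμ s) (hK s t)
      by_cases h0 : ρ r₀ ≤ a
      · rw [hbK]
        refine Finset.sum_pos' (fun s _ => Finset.sum_nonneg fun t _ => hnn s t) ⟨s₂, ?_, ?_⟩
        · simpa [hs₂] using hab'
        · exact Finset.sum_pos' (fun t _ => hnn _ t) ⟨r₀, by simpa using h0, mul_pos hμs₂ (hr _)⟩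
      · refine Finset.sum_pos' (fun s _ => Finset.sum_nonneg fun t _ => hnn s t) ⟨s₁, ?_, ?_⟩
        · simp [hs₁]
        · exact Finset.sum_pos' (fun t _ => hnn _ t) ⟨r₀, by simpa using h0, mul_pos hμs₁ (hr _)⟩
    have hfin : b' * F ≤ (G * a) * F := by
      rw [hbL] at hup
      linarith
    exact le_of_mul_le_mul_right hfin hFpos
  rcases (hμ s).eq_or_lt with hs | hs
  · rw [hρν s, ← hs]
    simp
  rcases (hμ t).eq_or_lt with ht | ht
  · rw [hρν t, ← ht]
    simp
  have hcard : (T.image ρ).card ≤ (Fintype.card σ - 1) + 1 := by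
    have h1 : (T.image ρ).card ≤ T.card := Finset.card_image_le
    have h2 : T.card ≤ Fintype.card σ := Finset.card_le_univ T
    omega
  have hle := le_pow_mul_of_gaps hG _ (T.image ρ) (fun a ha => by
      obtain ⟨s, hsT, rfl⟩ := Finset.mem_image.1 ha
      exact div_pos (hνμ _ ((hmemT s).1 hsT)) ((hmemT s).1 hsT)) hcard hgap
    (ρ t) (Finset.mem_image_of_mem ρ ((hmemT t).2 ht))
    (ρ s) (Finset.mem_image_of_mem ρ ((hmemT s).2 hs))
  rw [hρν s, hρν t]
  calc ρ s * μ s * μ t ≤ (G ^ (Fintype.card σ - 1) * ρ t) * μ s * μ t := by gcongr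
    _ = _ := by ring

end Stationary

/-! ### Abel means -/

/-- If the partial sums of `a` grow at most at the rate `b`, up to a constant `B`, then so do the
Abel means. -/
lemma abel_le_of_sum_le {a : ℕ → ℝ} {b B : ℝ} (ha : ∀ n, a n ∈ Set.Icc (0 : ℝ) 1)
    (h : ∀ n : ℕ, ∑ i ∈ Finset.range n, a i ≤ b * n + B) {ε : ℝ} (h0 : 0 < ε) (h1 : ε < 1) :
    ε * ∑' n, (1 - ε) ^ n * a n ≤ b + ε * B := by
  set x := 1 - ε with hx
  have hx0 : 0 ≤ x := by linarith
  have hx1 : x < 1 := by linarith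
  have hgeo := hasSum_geometric_of_lt_one hx0 hx1
  have hsum : Summable fun n => x ^ n * a n :=
    Summable.of_nonneg_of_le (fun n => mul_nonneg (pow_nonneg hx0 n) (ha n).1)
      (fun n => mul_le_of_le_one_right (pow_nonneg hx0 n) (ha n).2) hgeo.summable
  have hfin : ∀ M : ℕ, ∑ n ∈ Finset.range M, x ^ n * (a n - b) ≤
      B - x ^ M * (B - (∑ i ∈ Finset.range M, a i - b * M)) := by
    intro M
    induction M with
    | zero => simp
    | succ M ih =>
      have h2 : 0 ≤ B - (∑ i ∈ Finset.range (M + 1), a i - b * (M + 1 : ℕ)) := by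
        linarith [h (M + 1)]
      have h3 : x ^ (M + 1) * (B - (∑ i ∈ Finset.range (M + 1), a i - b * (M + 1 : ℕ))) ≤
          x ^ M * (B - (∑ i ∈ Finset.range (M + 1), a i - b * (M + 1 : ℕ))) :=
        mul_le_mul_of_nonneg_right (pow_le_pow_of_le_one hx0 hx1.le M.le_succ) h2
      refine le_trans ?_ (sub_le_sub_left h3 B)
      rw [Finset.sum_range_succ, Finset.sum_range_succ]
      push_cast
      linarith
  have hS : HasSum (fun n => x ^ n * (a n - b)) (∑' n, x ^ n * a n - (1 - x)⁻¹ * b) := by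
    simpa only [mul_sub] using hsum.hasSum.sub (hgeo.mul_right b)
  have hle : ∑' n, x ^ n * a n - (1 - x)⁻¹ * b ≤ B := by
    refine le_of_tendsto' hS.tendsto_sum_nat fun M => (hfin M).trans ?_
    have := mul_nonneg (pow_nonneg hx0 M) (sub_nonneg.2 (sub_le_iff_le_add'.2 (h M)))
    linarith
  have hx2 : 1 - x = ε := by rw [hx]; ring
  rw [hx2] at hle
  have h5 : ε * (∑' n, x ^ n * a n - ε⁻¹ * b) ≤ ε * B := mul_le_mul_of_nonneg_left hle h0.le
  rw [mul_sub, mul_inv_cancel_left₀ h0.ne'] at h5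
  linarith

section AbelMean

variable {σ : Type*} [Fintype σ] [DecidableEq σ]

/-- The law at time `n` of the Markov chain with kernel `K` started in `r₀`. -/
def chainLaw (K : σ → σ → ℝ) (r₀ : σ) : ℕ → σ → ℝ
  | 0 => fun t => if t = r₀ then 1 else 0
  | n + 1 => fun t => ∑ s, chainLaw K r₀ n s * K s t

/-- The Abel mean of the laws of a Markov chain, that is its law at an independent geometric time. -/
noncomputable def abelLaw (K : σ → σ → ℝ) (r₀ : σ) (ε : ℝ) (t : σ) : ℝ :=
  ε * ∑' n, (1 - ε) ^ n * chainLaw K r₀ n t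

/-- The kernel that restarts in `r₀` with probability `ε` and follows `K` otherwise. -/
def restart (K : σ → σ → ℝ) (r₀ : σ) (ε : ℝ) (s t : σ) : ℝ :=
  (1 - ε) * K s t + if t = r₀ then ε else 0

variable {K : σ → σ → ℝ} {r₀ : σ}

lemma chainLaw_nonneg (hK : ∀ s t, 0 ≤ K s t) (n : ℕ) (t : σ) : 0 ≤ chainLaw K r₀ n t := by
  induction n generalizing t with
  | zero => simp only [chainLaw]; split_ifs <;> norm_num
  | succ n ih => exact Finset.sum_nonneg fun s _ => mul_nonneg (ih s) (hK s t)

lemma chainLaw_sum (hK1 : ∀ s, ∑ t, K s t = 1) (n : ℕ) : ∑ t, chainLaw K r₀ n t = 1 := by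
  induction n with
  | zero => simp [chainLaw]
  | succ n ih =>
    simp only [chainLaw]
    rw [Finset.sum_comm]
    simp_rw [← Finset.mul_sum, hK1, mul_one, ih]

lemma abel_summable (hK : ∀ s t, 0 ≤ K s t) (hK1 : ∀ s, ∑ t, K s t = 1) {ε : ℝ} (h0 : 0 < ε)
    (h1 : ε < 1) (t : σ) : Summable fun n => (1 - ε) ^ n * chainLaw K r₀ n t := by
  have hx0 : 0 ≤ 1 - ε := by linarith
  refine Summable.of_nonneg_of_le
    (fun n => mul_nonneg (pow_nonneg hx0 n) (chainLaw_nonneg hK n t))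
    (fun n => mul_le_of_le_one_right (pow_nonneg hx0 n) ?_)
    (summable_geometric_of_lt_one hx0 (by linarith))
  rw [← chainLaw_sum (r₀ := r₀) hK1 n]
  exact Finset.single_le_sum (fun s _ => chainLaw_nonneg hK n s) (Finset.mem_univ t)

lemma abelLaw_nonneg (hK : ∀ s t, 0 ≤ K s t) {ε : ℝ} (h0 : 0 < ε) (h1 : ε < 1) (t : σ) :
    0 ≤ abelLaw K r₀ ε t :=
  mul_nonneg h0.le (tsum_nonneg fun n =>
    mul_nonneg (pow_nonneg (by linarith) n) (chainLaw_nonneg hK n t))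

lemma sum_abelLaw_mul (hK : ∀ s t, 0 ≤ K s t) (hK1 : ∀ s, ∑ t, K s t = 1) {ε : ℝ} (h0 : 0 < ε)
    (h1 : ε < 1) (V : σ → ℝ) :
    ∑ t, abelLaw K r₀ ε t * V t = ε * ∑' n, (1 - ε) ^ n * ∑ t, chainLaw K r₀ n t * V t := by
  simp only [abelLaw, Finset.mul_sum]
  rw [Summable.tsum_finsetSum fun t _ => by
    simpa only [mul_assoc] using (abel_summable hK hK1 h0 h1 t).mul_right (V t)]
  rw [Finset.mul_sum]
  refine Finset.sum_congr rfl fun t _ => ?_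
  rw [mul_assoc, ← tsum_mul_right]
  simp only [mul_assoc]

lemma abelLaw_sum (hK : ∀ s t, 0 ≤ K s t) (hK1 : ∀ s, ∑ t, K s t = 1) {ε : ℝ} (h0 : 0 < ε)
    (h1 : ε < 1) : ∑ t, abelLaw K r₀ ε t = 1 := by
  have h := sum_abelLaw_mul (r₀ := r₀) hK hK1 h0 h1 fun _ => 1
  simp only [mul_one, chainLaw_sum hK1] at h
  rw [h, tsum_geometric_of_lt_one (by linarith) (by linarith), sub_sub_cancel,
    mul_inv_cancel₀ h0.ne']

lemma restart_sum (hK1 : ∀ s, ∑ t, K s t = 1) (ε : ℝ) (s : σ) :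
    ∑ t, restart K r₀ ε s t = 1 := by
  simp [restart, Finset.sum_add_distrib, ← Finset.mul_sum, hK1]

/-- The Abel mean is stationary for the restarted chain, whose runs between restarts have
independent geometric lengths. -/
lemma abelLaw_stationary (hK : ∀ s t, 0 ≤ K s t) (hK1 : ∀ s, ∑ t, K s t = 1) {ε : ℝ}
    (h0 : 0 < ε) (h1 : ε < 1) (t : σ) :
    ∑ s, abelLaw K r₀ ε s * restart K r₀ ε s t = abelLaw K r₀ ε t := by
  have h2 : ∑ s, abelLaw K r₀ ε s * restart K r₀ ε s t =
      (1 - ε) * ∑ s, abelLaw K r₀ ε s * K s t + if t = r₀ then ε else 0 := by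
    simp only [restart, mul_add, Finset.sum_add_distrib]
    rw [← Finset.sum_mul, abelLaw_sum hK hK1 h0 h1, one_mul, Finset.mul_sum]
    congr 1
    exact Finset.sum_congr rfl fun s _ => by ring
  rw [h2, sum_abelLaw_mul hK hK1 h0 h1]
  conv_rhs => rw [abelLaw, (abel_summable hK hK1 h0 h1 t).tsum_eq_zero_add]
  simp only [chainLaw, pow_zero, one_mul, pow_succ']
  simp only [mul_assoc (1 - ε)]
  rw [tsum_mul_left]
  split_ifs <;> ring

end AbelMean

/-! ### Memoryless adversaries -/

/-- The kernel of the state process when the samples are independent with distribution `p`. -/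
def iidKernel (D : FSM X S) (p : X → ℝ) (s t : Fin S) : ℝ := ∑ y, p y * D.trans s y t

lemma iidKernel_nonneg (D : FSM X S) {p : X → ℝ} (hp : p ∈ stdSimplex ℝ X) (s t : Fin S) :
    0 ≤ iidKernel D p s t :=
  Finset.sum_nonneg fun y _ => mul_nonneg (hp.1 y) (D.trans_nonneg s y t)

lemma iidKernel_sum (D : FSM X S) {p : X → ℝ} (hp : p ∈ stdSimplex ℝ X) (s : Fin S) :
    ∑ t, iidKernel D p s t = 1 := by
  unfold iidKernel
  rw [Finset.sum_comm]
  simp_rw [← Finset.mul_sum, D.trans_sum, mul_one]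
  exact hp.2

lemma stepExp_eq_sum_iidKernel (D : FSM X S) (p : X → ℝ) (s : Fin S) (V : Fin S → ℝ) :
    stepExp D p s V = ∑ t, iidKernel D p s t * V t := by
  simp only [stepExp, iidKernel, Finset.mul_sum, Finset.sum_mul]
  rw [Finset.sum_comm]
  simp only [mul_assoc]

/-- The strategy that draws independent samples from `p`. -/
def iidStrategy {P : Set (X → ℝ)} (S : ℕ) (p : P) : Strategy S P := fun _ _ _ => p

lemma stateExp_iidStrategy {P : Set (X → ℝ)} (D : FSM X S) (r₀ : Fin S) (p : P) (n : ℕ)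
    (V : Fin S → ℝ) :
    stateExp D r₀ (iidStrategy S p) n V =
      ∑ s, chainLaw (iidKernel D p) r₀ n s * V s := by
  induction n generalizing V with
  | zero => simp [stateExp_zero, chainLaw]
  | succ n ih =>
    rw [stateExp_succ]
    refine (ih fun s => stepExp D p s V).trans ?_
    simp only [chainLaw, stepExp_eq_sum_iidKernel, Finset.sum_mul, Finset.mul_sum]
    rw [Finset.sum_comm]
    simp only [mul_assoc]

/-- The Abel mean of the error probabilities against a memoryless adversary. -/
lemma abel_errProb {P : Set (X → ℝ)} (hP : P ⊆ stdSimplex ℝ X) (D : FSM X S) (r₀ : Fin S) (p : P)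
    (h : Fin 2) {ε : ℝ} (h0 : 0 < ε) (h1 : ε < 1) :
    ε * ∑' n, (1 - ε) ^ n * errProb D r₀ (iidStrategy S p) h n =
      ∑ s with D.decision s ≠ h, abelLaw (iidKernel D p) r₀ ε s := by
  have hp := hP p.2
  simp only [errProb_eq_stateExp, stateExp_iidStrategy]
  rw [← sum_abelLaw_mul (iidKernel_nonneg D hp) (iidKernel_sum D hp) h0 h1]
  simp [Finset.sum_ite]

/-- The trade-off between the Abel means of the two error probabilities against two memoryless
adversaries whose likelihood ratio varies by a factor of at most `G`. -/
lemma abelLaw_tradeoff (D : FSM X S) (r₀ : Fin S) {p q : X → ℝ} (hp : p ∈ stdSimplex ℝ X)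
    (hq : q ∈ stdSimplex ℝ X) {c G : ℝ} (hpq : ∀ x, p x ≤ c * q x) (hqp : ∀ x, c * q x ≤ G * p x)
    {ε : ℝ} (h0 : 0 < ε) (h1 : ε < 1) :
    (1 - ∑ s with D.decision s ≠ 1, abelLaw (iidKernel D q) r₀ ε s) *
        (1 - ∑ s with D.decision s ≠ 0, abelLaw (iidKernel D p) r₀ ε s) ≤
      G ^ (S - 1) * ((∑ s with D.decision s ≠ 0, abelLaw (iidKernel D p) r₀ ε s) *
        ∑ s with D.decision s ≠ 1, abelLaw (iidKernel D q) r₀ ε s) := by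
  have hc1 : 1 ≤ c := by
    have := Finset.sum_le_sum fun x (_ : x ∈ Finset.univ) => hpq x
    rwa [← Finset.mul_sum, hp.2, hq.2, mul_one] at this
  have hcG : c ≤ G := by
    have := Finset.sum_le_sum fun x (_ : x ∈ Finset.univ) => hqp x
    rwa [← Finset.mul_sum, ← Finset.mul_sum, hp.2, hq.2, mul_one, mul_one] at this
  set K := iidKernel D p with hK
  set L := iidKernel D q with hL
  have hK0 := iidKernel_nonneg D hp
  have hL0 := iidKernel_nonneg D hq
  have hK1 := iidKernel_sum D hp
  have hL1 := iidKernel_sum D hq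
  have hKL : ∀ s t, K s t ≤ c * L s t := fun s t => by
    simp only [hK, hL, iidKernel, Finset.mul_sum]
    refine Finset.sum_le_sum fun y _ => ?_
    rw [← mul_assoc]
    exact mul_le_mul_of_nonneg_right (hpq y) (D.trans_nonneg _ _ _)
  have hLK : ∀ s t, c * L s t ≤ G * K s t := fun s t => by
    simp only [hK, hL, iidKernel, Finset.mul_sum]
    refine Finset.sum_le_sum fun y _ => ?_
    rw [← mul_assoc, ← mul_assoc]
    exact mul_le_mul_of_nonneg_right (hqp y) (D.trans_nonneg _ _ _)
  have hε : 0 ≤ 1 - ε := by linarith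
  have hrest : ∀ {M : Fin S → Fin S → ℝ}, (∀ s t, 0 ≤ M s t) →
      ∀ s t, 0 ≤ restart M r₀ ε s t := fun hM s t => by
    unfold restart
    have := mul_nonneg hε (hM s t)
    split_ifs <;> linarith
  have key := stationary_ratio_le (hrest hK0) (hrest hL0) (restart_sum hK1 ε) (restart_sum hL1 ε)
    (c := c) (G := G) (by linarith) (by linarith)
    (fun s t => by
      have h2 := mul_le_mul_of_nonneg_left (hKL s t) hε
      have h3 : ε ≤ c * ε := le_mul_of_one_le_left h0.le hc1
      unfold restart
      split_ifs <;> linarith)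
    (fun s t => by
      have h2 := mul_le_mul_of_nonneg_left (hLK s t) hε
      have h3 : c * ε ≤ G * ε := mul_le_mul_of_nonneg_right hcG h0.le
      unfold restart
      split_ifs <;> linarith)
    (abelLaw_nonneg hK0 h0 h1) (abelLaw_nonneg hL0 h0 h1) (abelLaw_sum hK0 hK1 h0 h1)
    (abelLaw_sum hL0 hL1 h0 h1) (abelLaw_stationary hK0 hK1 h0 h1)
    (abelLaw_stationary hL0 hL1 h0 h1)
    (fun s => by
      have := mul_nonneg hε (hK0 s r₀)
      show 0 < restart K r₀ ε s r₀
      rw [restart, if_pos rfl]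
      linarith)
  rw [Fintype.card_fin] at key
  have e1 : 1 - ∑ s with D.decision s ≠ 1, abelLaw L r₀ ε s =
      ∑ s with D.decision s ≠ 0, abelLaw L r₀ ε s := by
    rw [← abelLaw_sum (r₀ := r₀) hL0 hL1 h0 h1, ← Finset.sum_filter_add_sum_filter_not Finset.univ
      (fun s => D.decision s ≠ 1), add_sub_cancel_left]
    refine Finset.sum_congr (Finset.filter_congr fun s _ => ?_) fun _ _ => rfl
    omega
  have e0 : 1 - ∑ s with D.decision s ≠ 0, abelLaw K r₀ ε s =
      ∑ s with D.decision s ≠ 1, abelLaw K r₀ ε s := by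
    rw [← abelLaw_sum (r₀ := r₀) hK0 hK1 h0 h1, ← Finset.sum_filter_add_sum_filter_not Finset.univ
      (fun s => D.decision s ≠ 0), add_sub_cancel_left]
    refine Finset.sum_congr (Finset.filter_congr fun s _ => ?_) fun _ _ => rfl
    omega
  rw [e0, e1, Finset.sum_mul_sum, Finset.sum_mul_sum, Finset.mul_sum]
  refine Finset.sum_le_sum fun s _ => ?_
  rw [Finset.mul_sum]
  exact Finset.sum_le_sum fun t _ => key s t

lemma sum_errProb_le_of_avgErr_le {P : Set (X → ℝ)} (hP : P ⊆ stdSimplex ℝ X) (D : FSM X S)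
    (r₀ : Fin S) (A : Strategy S P) (h : Fin 2) {b : ℝ} (hb : 0 ≤ b)
    (hav : ∀ᶠ n in atTop, avgErr D r₀ A h n ≤ b) :
    ∃ B, 0 ≤ B ∧ ∀ n : ℕ, ∑ i ∈ Finset.range n, errProb D r₀ A h i ≤ b * n + B := by
  obtain ⟨N, hN⟩ := eventually_atTop.1 hav
  refine ⟨N + 1, by positivity, fun n => ?_⟩
  rcases lt_or_ge n (N + 1) with hn | hn
  · have h1 : ∑ i ∈ Finset.range n, errProb D r₀ A h i ≤ ∑ i ∈ Finset.range n, (1 : ℝ) :=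
      Finset.sum_le_sum fun i _ => (errProb_mem_Icc hP D r₀ A h i).2
    have h2 : (n : ℝ) ≤ N + 1 := by exact_mod_cast hn.le
    have h3 : 0 ≤ b * n := by positivity
    simp at h1
    linarith
  · have hn0 : (0 : ℝ) < n := by exact_mod_cast (Nat.succ_pos N).trans_le hn
    have h1 := hN n (by omega)
    unfold avgErr at h1
    rw [one_div, inv_mul_le_iff₀ hn0] at h1
    have h2 : ∑ i ∈ Finset.range n, errProb D r₀ A h i ≤
        errProb D r₀ A h 0 + ∑ i ∈ Finset.Icc 1 n, errProb D r₀ A h i := by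
      rw [← Finset.sum_insert (by simp)]
      refine Finset.sum_le_sum_of_subset_of_nonneg (fun i hi => ?_) fun i _ _ =>
        (errProb_mem_Icc hP D r₀ A h i).1
      simp only [Finset.mem_insert, Finset.mem_Icc, Finset.mem_range] at *
      omega
    have h3 := (errProb_mem_Icc hP D r₀ A h 0).2
    have h4 : (0 : ℝ) ≤ N := by positivity
    linarith

/-- Two error probabilities below `1 / (1 + √g)` violate the trade-off with constant `g`. -/
lemma lt_mul_of_lt_inv {g u v : ℝ} (hg : 0 ≤ g)
    (hu : u < 1 / (1 + √g)) (hv : v < 1 / (1 + √g)) (hu0 : 0 ≤ u) (hv0 : 0 ≤ v) :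
    g * (u * v) < (1 - v) * (1 - u) := by
  have hs := Real.sqrt_nonneg g
  rw [lt_div_iff₀ (by linarith)] at hu hv
  have h1 : √g * u < 1 - u := by linarith
  have h2 : √g * v < 1 - v := by linarith
  calc g * (u * v) = (√g * v) * (√g * u) := by
        conv_lhs => rw [← Real.mul_self_sqrt hg]
        ring
    _ < (1 - v) * (1 - u) := mul_lt_mul'' h2 h1 (by positivity) (by positivity)

/-- The lower bound, given one pair of distributions whose likelihood ratio varies little. -/
lemma le_asympErr_of_comparable {P : Fin 2 → Set (X → ℝ)} (hP : ∀ h, P h ⊆ stdSimplex ℝ X)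
    (D : FSM X S) (r₀ : Fin S) (p : (h : Fin 2) → P h) {c G : ℝ} (hG : 0 ≤ G)
    (hpq : ∀ x, (p 0 : X → ℝ) x ≤ c * (p 1 : X → ℝ) x)
    (hqp : ∀ x, c * (p 1 : X → ℝ) x ≤ G * (p 0 : X → ℝ) x) :
    ENNReal.ofReal (1 / (1 + √(G ^ (S - 1)))) ≤ asympErr D r₀ fun h => iidStrategy S (p h) := by
  by_contra! hlt
  obtain ⟨b, hb1, hb2⟩ := exists_between hlt
  have hbtop : b ≠ ∞ := ne_top_of_lt hb2
  have hbR : b.toReal < 1 / (1 + √(G ^ (S - 1))) :=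
    (ENNReal.lt_ofReal_iff_toReal_lt hbtop).1 hb2
  have hev : ∀ h, ∃ B, 0 ≤ B ∧ ∀ n : ℕ, ∑ i ∈ Finset.range n,
      errProb D r₀ (iidStrategy S (p h)) h i ≤ b.toReal * n + B := fun h => by
    refine sum_errProb_le_of_avgErr_le (hP h) D r₀ _ h ENNReal.toReal_nonneg ?_
    have h1 := (le_iSup (fun h : Fin 2 => limsup (fun n : ℕ => ENNReal.ofReal
      (avgErr D r₀ (iidStrategy S (p h)) h n)) atTop) h).trans_lt hb1
    filter_upwards [eventually_lt_of_limsup_lt h1] with n hn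
    exact (ENNReal.ofReal_le_iff_le_toReal hbtop).1 hn.le
  choose B hB0 hB using hev
  -- small enough for both Abel means to stay below the bound
  obtain ⟨ε, hε0, hε1, hεB⟩ : ∃ ε : ℝ, 0 < ε ∧ ε < 1 ∧
      ε * (B 0 + B 1) < 1 / (1 + √(G ^ (S - 1))) - b.toReal := by
    have hd : 0 < 1 / (1 + √(G ^ (S - 1))) - b.toReal := by linarith
    have hBn : 0 ≤ B 0 + B 1 := add_nonneg (hB0 0) (hB0 1)
    refine ⟨min (1 / 2) ((1 / (1 + √(G ^ (S - 1))) - b.toReal) / (B 0 + B 1 + 1)),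
      by positivity, (min_le_left _ _).trans_lt (by norm_num), ?_⟩
    calc _ ≤ (1 / (1 + √(G ^ (S - 1))) - b.toReal) / (B 0 + B 1 + 1) * (B 0 + B 1) :=
          mul_le_mul_of_nonneg_right (min_le_right _ _) hBn
      _ < (1 / (1 + √(G ^ (S - 1))) - b.toReal) / (B 0 + B 1 + 1) * (B 0 + B 1 + 1) :=
          mul_lt_mul_of_pos_left (by linarith) (by positivity)
      _ = _ := by field_simp
  have hab : ∀ h, ∑ s with D.decision s ≠ h, abelLaw (iidKernel D (p h)) r₀ ε s <
      1 / (1 + √(G ^ (S - 1))) := fun h => by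
    rw [← abel_errProb (hP h) D r₀ (p h) h hε0 hε1]
    have h1 := abel_le_of_sum_le (fun n => errProb_mem_Icc (hP h) D r₀ _ h n) (hB h) hε0 hε1
    have h2 : ε * B h ≤ ε * (B 0 + B 1) := by
      refine mul_le_mul_of_nonneg_left ?_ hε0.le
      fin_cases h
      · simpa using hB0 1
      · simpa using hB0 0
    linarith
  have hnn : ∀ h, 0 ≤ ∑ s with D.decision s ≠ h, abelLaw (iidKernel D (p h)) r₀ ε s := fun h =>
    Finset.sum_nonneg fun s _ => abelLaw_nonneg (iidKernel_nonneg D (hP h (p h).2)) hε0 hε1 s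
  exact absurd (abelLaw_tradeoff D r₀ (hP 0 (p 0).2) (hP 1 (p 1).2) hpq hqp hε0 hε1)
    (not_le.2 (lt_mul_of_lt_inv (pow_nonneg hG _) (hab 0) (hab 1) (hnn 0) (hnn 1)))

/-! ### A pair of distributions that attains `γ` -/

lemma expect_add (p f g : X → ℝ) : expect p (fun x => f x + g x) = expect p f + expect p g := by
  simp [expect, mul_add, Finset.sum_add_distrib]

lemma expect_const {p : X → ℝ} (hp : p ∈ stdSimplex ℝ X) (a : ℝ) : expect p (fun _ => a) = a := by
  simp [expect, ← Finset.sum_mul, hp.2]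

lemma expect_const_mul (p f : X → ℝ) (a : ℝ) :
    expect p (fun x => a * f x) = a * expect p f := by
  simp only [expect, Finset.mul_sum]
  exact Finset.sum_congr rfl fun x _ => by ring

lemma expect_nonneg {p f : X → ℝ} (hp : p ∈ stdSimplex ℝ X) (hf : ∀ x, 0 ≤ f x) :
    0 ≤ expect p f := Finset.sum_nonneg fun x _ => mul_nonneg (hp.1 x) (hf x)

lemma expect_mono {p f g : X → ℝ} (hp : p ∈ stdSimplex ℝ X) (h : ∀ x, f x ≤ g x) :
    expect p f ≤ expect p g :=
  Finset.sum_le_sum fun x _ => mul_le_mul_of_nonneg_left (h x) (hp.1 x)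

lemma continuous_expect (f : X → ℝ) : Continuous fun p => expect p f := by
  unfold expect
  fun_prop

lemma exists_isMaxOn_expect {P : Set (X → ℝ)} (hP : P ⊆ stdSimplex ℝ X) (hne : P.Nonempty)
    (hcl : IsClosed P) (f : X → ℝ) : ∃ q ∈ P, ∀ q' ∈ P, expect q' f ≤ expect q f :=
  ((isCompact_stdSimplex ℝ X).of_isClosed_subset hcl hP).exists_isMaxOn hne
    (continuous_expect f).continuousOn

/-- With a positive bound, a ratio bound in `ℝ≥0∞` is an inequality between products together with
the positivity of the numerator, which excludes `0 / 0`. -/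
lemma le_ofReal_div_ofReal_iff {a N M : ℝ} (ha : 0 < a) (hM : 0 ≤ M) :
    ENNReal.ofReal a ≤ ENNReal.ofReal N / ENNReal.ofReal M ↔ 0 < N ∧ a * M ≤ N := by
  rcases hM.eq_or_lt with rfl | hM
  · rcases lt_or_ge 0 N with hN | hN
    · simp [ENNReal.div_zero, hN, hN.le]
    · simp [ENNReal.ofReal_of_nonpos hN, ha.not_ge, hN.not_gt]
  · rw [ENNReal.le_div_iff_mul_le (Or.inl (by simpa using hM)) (Or.inl ENNReal.ofReal_ne_top),
      ← ENNReal.ofReal_mul ha.le]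
    have h1 : 0 < a * M := mul_pos ha hM
    constructor
    · intro h
      have h2 : 0 < N := by
        by_contra! hN
        rw [ENNReal.ofReal_of_nonpos hN] at h
        exact absurd (ENNReal.ofReal_eq_zero.1 (nonpos_iff_eq_zero.1 h)) (not_le.2 h1)
      exact ⟨h2, (ENNReal.ofReal_le_ofReal_iff h2.le).1 h⟩
    · rintro ⟨-, h⟩
      exact ENNReal.ofReal_le_ofReal h

/-- Non-negative functions, scaled down, become admissible weights: the ratio is homogeneous. -/
lemma le_gammaConst_of_nonneg {P : Fin 2 → Set (X → ℝ)} (hP : ∀ h, P h ⊆ stdSimplex ℝ X)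
    {f g : X → ℝ} (hf : ∀ x, 0 ≤ f x) (hg : ∀ x, 0 ≤ g x) {a : ℝ} (ha : 0 < a)
    (h : ∀ p ∈ P 0, ∀ q ∈ P 1, 0 < expect q f * expect p g ∧
      a * (expect q g * expect p f) ≤ expect q f * expect p g) :
    ENNReal.ofReal a ≤ gammaConst P := by
  set M : ℝ := 1 + ∑ x, (f x + g x) with hM
  have hM0 : 0 < M := by
    have : 0 ≤ ∑ x, (f x + g x) := Finset.sum_nonneg fun x _ => add_nonneg (hf x) (hg x)
    linarith
  have hle : ∀ x, f x + g x ≤ M := fun x => by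
    have := Finset.single_le_sum (f := fun x => f x + g x)
      (fun x _ => add_nonneg (hf x) (hg x)) (Finset.mem_univ x)
    linarith
  have hw : ((fun x => M⁻¹ * f x, fun x => M⁻¹ * g x) : (X → ℝ) × (X → ℝ)) ∈ weights X := by
    intro x
    refine ⟨mul_nonneg (by positivity) (hf x), mul_nonneg (by positivity) (hg x), ?_⟩
    simp only
    rw [← mul_add, inv_mul_le_iff₀ hM0, mul_one]
    exact hle x
  refine le_iSup₂_of_le _ hw (le_iInf₂ fun p hp => le_iInf₂ fun q hq => ?_)
  unfold ratio
  simp only [expect_const_mul]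
  have hp' := hP 0 hp
  have hq' := hP 1 hq
  obtain ⟨h1, h2⟩ := h p hp q hq
  rw [le_ofReal_div_ofReal_iff ha (mul_nonneg
    (mul_nonneg (by positivity) (expect_nonneg hq' hg))
    (mul_nonneg (by positivity) (expect_nonneg hp' hf)))]
  constructor
  · have : M⁻¹ * expect q f * (M⁻¹ * expect p g) = M⁻¹ * M⁻¹ * (expect q f * expect p g) := by ring
    rw [this]
    positivity
  · calc a * (M⁻¹ * expect q g * (M⁻¹ * expect p f))
        = M⁻¹ * M⁻¹ * (a * (expect q g * expect p f)) := by ring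
      _ ≤ M⁻¹ * M⁻¹ * (expect q f * expect p g) := by gcongr
      _ = _ := by ring

lemma one_le_gammaConst {P : Fin 2 → Set (X → ℝ)} (hP : ∀ h, P h ⊆ stdSimplex ℝ X) :
    1 ≤ gammaConst P := by
  rw [← ENNReal.ofReal_one]
  refine le_gammaConst_of_nonneg hP (f := fun _ => 1) (g := fun _ => 1) (by simp) (by simp)
    one_pos fun p hp q hq => ?_
  rw [expect_const (hP 0 hp), expect_const (hP 1 hq)]
  norm_num

/-- A linear form on pairs of functions that is bounded below on the non-negative pairs is given by
non-negative weights. -/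
lemma exists_weights_of_bounded_below (F : ((X → ℝ) × (X → ℝ)) →L[ℝ] ℝ) {v : ℝ}
    (hF : ∀ z, 0 ≤ z → v < F z) : ∃ l m : X → ℝ, (∀ x, 0 ≤ l x) ∧ (∀ x, 0 ≤ m x) ∧
      ∀ a b : X → ℝ, F (a, b) = expect a l + expect b m := by
  classical
  have hnn : ∀ z, 0 ≤ z → 0 ≤ F z := by
    intro z hz
    by_contra! hneg
    obtain ⟨n, hn⟩ := exists_nat_gt (v / F z)
    have h1 := hF ((n : ℝ) • z) (smul_nonneg (by positivity) hz)
    rw [map_smul, smul_eq_mul] at h1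
    rw [div_lt_iff_of_neg hneg] at hn
    linarith
  refine ⟨fun x => F (Pi.single x 1, 0), fun x => F (0, Pi.single x 1), fun x => hnn _ ?_,
    fun x => hnn _ ?_, fun a b => ?_⟩
  · exact Prod.mk_le_mk.2 ⟨Pi.single_nonneg.2 zero_le_one, le_rfl⟩
  · exact Prod.mk_le_mk.2 ⟨le_rfl, Pi.single_nonneg.2 zero_le_one⟩
  · have hlin : ∀ (H : (X → ℝ) →ₗ[ℝ] ℝ) (a : X → ℝ),
        H a = expect a fun x => H (Pi.single x 1) := fun H a => by
      conv_lhs => rw [pi_eq_sum_univ' a, map_sum]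
      refine Finset.sum_congr rfl fun x _ => ?_
      rw [map_smul, smul_eq_mul]
    have ha := hlin (F.toLinearMap.comp (LinearMap.inl ℝ (X → ℝ) (X → ℝ))) a
    have hb := hlin (F.toLinearMap.comp (LinearMap.inr ℝ (X → ℝ) (X → ℝ))) b
    simp only [LinearMap.comp_apply, LinearMap.inl_apply, LinearMap.inr_apply,
      ContinuousLinearMap.coe_coe] at ha hb
    rw [← ha, ← hb, ← map_add, Prod.mk_add_mk, add_zero, zero_add]

/-- The minimax identity behind the lower bound: if `γ` is finite, then some `p ∈ P 0` and
`q ∈ P 1` have a likelihood ratio that varies by a factor of at most `γ`. Otherwise a hyperplane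
separates the pairs `(c q - p, γ p - c q)` from the non-negative ones, and the coefficients of the
hyperplane are weights that beat `γ`. -/
lemma exists_comparable {P : Fin 2 → Set (X → ℝ)} (hP : ∀ h, P h ⊆ stdSimplex ℝ X)
    (hne : ∀ h, (P h).Nonempty) (hcl : ∀ h, IsClosed (P h)) (hcv : ∀ h, Convex ℝ (P h))
    {G : ℝ} (hG : gammaConst P = ENNReal.ofReal G) (hG1 : 1 ≤ G) :
    ∃ p ∈ P 0, ∃ q ∈ P 1, ∃ c : ℝ, (∀ x, p x ≤ c * q x) ∧ ∀ x, c * q x ≤ G * p x := by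
  by_contra! hcon
  have hcpt : ∀ h, IsCompact (P h) := fun h =>
    (isCompact_stdSimplex ℝ X).of_isClosed_subset (hcl h) (hP h)
  -- the multiples `c q` with `c ∈ [1, G]`, the only ones that can be comparable to some `p`
  set Q : Set (X → ℝ) := (fun z : ℝ × (X → ℝ) => z.1 • z.2) '' (Set.Icc 1 G ×ˢ P 1) with hQ
  have hQcpt : IsCompact Q := (isCompact_Icc.prod (hcpt 1)).image (by fun_prop)
  have hQcv : Convex ℝ Q := by
    rintro _ ⟨⟨c, q⟩, ⟨hc, hq⟩, rfl⟩ _ ⟨⟨c', q'⟩, ⟨hc', hq'⟩, rfl⟩ a b ha hb hab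
    simp only [Set.mem_Icc] at hc hc' hq hq'
    have hs := (convex_Icc 1 G) hc hc' ha hb hab
    simp only [smul_eq_mul] at hs
    have hs0 : 0 < a * c + b * c' := by linarith [hs.1]
    refine ⟨(a * c + b * c', (a * c / (a * c + b * c')) • q + (b * c' / (a * c + b * c')) • q'),
      ⟨hs, hcv 1 hq hq' (div_nonneg (mul_nonneg ha (by linarith)) hs0.le)
        (div_nonneg (mul_nonneg hb (by linarith)) hs0.le) ?_⟩, ?_⟩
    · rw [← add_div, div_self hs0.ne']
    · simp only [smul_add, smul_smul, mul_div_cancel₀ _ hs0.ne']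
  set T : ((X → ℝ) × (X → ℝ)) →ₗ[ℝ] ((X → ℝ) × (X → ℝ)) :=
    LinearMap.prod (LinearMap.snd ℝ _ _ - LinearMap.fst ℝ _ _)
      (G • LinearMap.fst ℝ _ _ - LinearMap.snd ℝ _ _) with hT
  have hdisj : Disjoint (T '' (P 0 ×ˢ Q)) (Set.Ici 0) := by
    rw [Set.disjoint_left]
    rintro _ ⟨⟨p, w⟩, ⟨hp, ⟨c, q⟩, ⟨hc, hq⟩, rfl⟩, rfl⟩ hz
    obtain ⟨h1, h2⟩ := Prod.le_def.1 (Set.mem_Ici.1 hz)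
    obtain ⟨x, hx⟩ := hcon p hp q hq c fun x => by simpa [hT] using h1 x
    exact absurd (by simpa [hT] using h2 x) (not_le.2 hx)
  obtain ⟨F, u, v, hF1, huv, hF2⟩ := geometric_hahn_banach_compact_closed
    (((hcv 0).prod hQcv).linear_image T)
    (((hcpt 0).prod hQcpt).image (LinearMap.continuous_of_finiteDimensional T))
    (convex_Ici 0) isClosed_Ici hdisj
  have hu : u < 0 := by simpa using huv.trans (hF2 0 (Set.mem_Ici.2 le_rfl))
  obtain ⟨l, m, hl, hm, hFlm⟩ := exists_weights_of_bounded_below F hF2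
  have hsep : ∀ p ∈ P 0, ∀ q ∈ P 1, ∀ c ∈ Set.Icc 1 G,
      c * (expect q l - expect q m) - expect p l + G * expect p m < u := by
    intro p hp q hq c hc
    have h1 := hF1 (T (p, c • q)) ⟨(p, c • q), ⟨hp, (c, q), ⟨hc, hq⟩, rfl⟩, rfl⟩
    have h2 : T (p, c • q) = (c • q - p, G • p - c • q) := rfl
    rw [h2, hFlm] at h1
    have h3 : expect (c • q - p) l + expect (G • p - c • q) m =
        c * (expect q l - expect q m) - expect p l + G * expect p m := by
      simp only [expect, Pi.sub_apply, Pi.smul_apply, smul_eq_mul, sub_mul, mul_assoc,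
        Finset.sum_sub_distrib, ← Finset.mul_sum]
      ring
    rwa [h3] at h1
  obtain ⟨q₀, hq₀, hmax⟩ := exists_isMaxOn_expect (hP 1) (hne 1) (hcl 1) fun x => l x + -1 * m x
  have hlm : ∀ q, expect q (fun x => l x + -1 * m x) = expect q l - expect q m := fun q => by
    rw [expect_add, expect_const_mul]
    ring
  simp only [hlm] at hmax
  set d := expect q₀ l - expect q₀ m with hd
  -- shift the weights so that `E_q l ≤ E_q m` holds for all `q`, with equality for `q₀`
  set a := max (-d) 0 with ha
  set b := max d 0 with hb
  have hab : a - b = -d := by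
    rw [ha, hb, max_comm d 0, max_comm (-d) 0]
    rcases le_total 0 d with h | h
    · rw [max_eq_left (by linarith : -d ≤ 0), max_eq_right h]
      ring
    · rw [max_eq_right (by linarith : 0 ≤ -d), max_eq_left h]
      ring
  have hpd : ∀ p ∈ P 0, G * (expect p m + b) - u < expect p l + a := by
    intro p hp
    rcases le_total 0 d with h | h
    · have h1 := hsep p hp q₀ hq₀ G ⟨hG1, le_rfl⟩
      rw [ha, hb, max_eq_left h, max_eq_right (by linarith : -d ≤ 0)]
      rw [← hd] at h1
      linarith
    · have h1 := hsep p hp q₀ hq₀ 1 ⟨le_rfl, hG1⟩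
      rw [ha, hb, max_eq_right h, max_eq_left (by linarith : 0 ≤ -d)]
      rw [← hd] at h1
      linarith
  have ha0 : 0 ≤ a := le_max_right _ _
  have hb0 : 0 ≤ b := le_max_right _ _
  -- a further positive constant in `f` keeps the numerators away from zero
  set e := -u / (2 * G) with he
  have he0 : 0 < e := div_pos (by linarith) (by linarith)
  have hGe : G * e = -u / 2 := by rw [he]; field_simp
  set B := ∑ x, m x + b + e with hB
  have hmsum : 0 ≤ ∑ x, m x := Finset.sum_nonneg fun x _ => hm x
  have hB0 : 0 < B := by linarith
  have hη : 0 < -u / 2 / B := div_pos (by linarith) hB0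
  have hlt : ENNReal.ofReal G < ENNReal.ofReal (G + -u / 2 / B) :=
    (ENNReal.ofReal_lt_ofReal_iff (by linarith)).2 (by linarith)
  rw [← hG] at hlt
  refine absurd ?_ (not_le.2 hlt)
  refine le_gammaConst_of_nonneg hP (f := fun x => m x + (b + e)) (g := fun x => l x + a)
    (fun x => by linarith [hm x]) (fun x => by linarith [hl x]) (by linarith) ?_
  intro p hp q hq
  have hp' := hP 0 hp
  have hq' := hP 1 hq
  simp only [expect_add, expect_const hp', expect_const hq']
  have hpm := expect_nonneg hp' hm
  have hqm := expect_nonneg hq' hm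
  have hql := expect_nonneg hq' hl
  have hpl := hpd p hp
  have hqd := hmax q hq
  have hpB : expect p m + (b + e) ≤ B := by
    have : expect p m ≤ expect p fun _ => ∑ x, m x := expect_mono hp' fun x =>
      Finset.single_le_sum (fun x _ => hm x) (Finset.mem_univ x)
    rw [expect_const hp'] at this
    linarith
  have h1 : (G + -u / 2 / B) * (expect p m + (b + e)) ≤ expect p l + a := by
    have h2 : -u / 2 / B * (expect p m + (b + e)) ≤ -u / 2 := by
      calc -u / 2 / B * (expect p m + (b + e)) ≤ -u / 2 / B * B := by gcongr
        _ = -u / 2 := by field_simp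
    linarith
  have h3 : expect q l + a ≤ expect q m + (b + e) := by linarith
  have h4 : 0 ≤ (G + -u / 2 / B) * (expect p m + (b + e)) :=
    mul_nonneg (by linarith) (by linarith)
  have h5 : 0 < expect p l + a := by
    refine lt_of_lt_of_le (mul_pos (by linarith) (by linarith)) h1
  refine ⟨mul_pos (by linarith) h5, ?_⟩
  calc (G + -u / 2 / B) * ((expect q l + a) * (expect p m + (b + e)))
      = (expect q l + a) * ((G + -u / 2 / B) * (expect p m + (b + e))) := by ring
    _ ≤ (expect q m + (b + e)) * (expect p l + a) :=
      mul_le_mul h3 h1 h4 (by linarith)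

/-! ### The birth-death machine -/

/-- The machine on `0, …, m + 1` that moves one step up from `s` on input `y` with probability
`up s y`, one step down with probability `down s y`, and otherwise stays. A step up from `m + 1` and
a step down from `0` stay in place as well. It decides `0` in the state `0` only. -/
def walk (m : ℕ) (up down : ℕ → X → ℝ) (hu : ∀ s y, 0 ≤ up s y) (hd : ∀ s y, 0 ≤ down s y)
    (h : ∀ s y, up s y + down s y ≤ 1) : FSM X (m + 2) where
  trans s y t := up s y * (if t = (⟨min (s + 1) (m + 1), by omega⟩ : Fin (m + 2)) then 1 else 0) +
    down s y * (if t = (⟨s - 1, by omega⟩ : Fin (m + 2)) then 1 else 0) +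
    (1 - up s y - down s y) * (if t = s then 1 else 0)
  trans_nonneg s y t := by
    have h1 : 0 ≤ 1 - up s y - down s y := by linarith [h s y]
    exact add_nonneg (add_nonneg (mul_nonneg (hu s y) (by split_ifs <;> norm_num))
      (mul_nonneg (hd s y) (by split_ifs <;> norm_num)))
      (mul_nonneg h1 (by split_ifs <;> norm_num))
  trans_sum s y := by
    simp [Finset.sum_add_distrib]
  decision s := if s = 0 then 0 else 1

lemma stepExp_walk {m : ℕ} {up down : ℕ → X → ℝ} {hu : ∀ s y, 0 ≤ up s y}
    {hd : ∀ s y, 0 ≤ down s y} {h : ∀ s y, up s y + down s y ≤ 1} {p : X → ℝ}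
    (hp : p ∈ stdSimplex ℝ X) (s : Fin (m + 2)) (V : ℕ → ℝ) :
    stepExp (walk m up down hu hd h) p s (fun t => V t) =
      V s + expect p (up s) * (V (min (s + 1) (m + 1)) - V s) +
        expect p (down s) * (V (s - 1) - V s) := by
  have h1 : ∀ y, ∑ t, (walk m up down hu hd h).trans s y t * V t =
      V s + up s y * (V (min (s + 1) (m + 1)) - V s) + down s y * (V (s - 1) - V s) := by
    intro y
    simp only [walk, add_mul, Finset.sum_add_distrib, mul_ite, mul_one, mul_zero, ite_mul, zero_mul,
      Finset.sum_ite_eq', Finset.mem_univ, if_true]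
    ring
  simp only [stepExp, h1, expect, mul_add, Finset.sum_add_distrib, ← Finset.sum_mul, hp.2, one_mul,
    ← mul_assoc]

/-- The potential of a birth-death chain that pays `1` everywhere except in its last state `m + 1`:
its decrements `D j` solve `D (j + 1) = β D j + (1 - e) / η`. Here `U` bounds the escape
probability of the state `0` from below, `β` the ratio of backward to forward steps and `η` the
forward steps in between, and `d₀` bounds the escape probability of the last state from above. -/
lemma exists_potential (m : ℕ) {U β η e d₀ : ℝ} (hU : 0 < U) (hβ : 0 ≤ β) (hη : 0 < η)
    (he : e ≤ 1)
    (h : d₀ * ((1 - e) * (β ^ m / U + (∑ i ∈ Finset.range m, β ^ i) / η)) ≤ e) :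
    ∃ V : ℕ → ℝ, (∀ u, U ≤ u → u * (V 1 - V 0) ≤ e - 1) ∧
      (∀ j u d, η ≤ u → d ≤ β * u →
        u * (V (j + 2) - V (j + 1)) + d * (V j - V (j + 1)) ≤ e - 1) ∧
      ∀ d, d ≤ d₀ → d * (V m - V (m + 1)) ≤ e := by
  set D : ℕ → ℝ := fun j => (1 - e) * (β ^ j / U + (∑ i ∈ Finset.range j, β ^ i) / η) with hD
  have he' : 0 ≤ 1 - e := by linarith
  have hD0 : ∀ j, 0 ≤ D j := fun j => by
    have : 0 ≤ ∑ i ∈ Finset.range j, β ^ i := Finset.sum_nonneg fun i _ => pow_nonneg hβ i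
    have h2 := pow_nonneg hβ j
    exact mul_nonneg he' (by positivity)
  have hDs : ∀ j, D (j + 1) = β * D j + (1 - e) / η := fun j => by
    have : ∑ i ∈ Finset.range (j + 1), β ^ i = β * (∑ i ∈ Finset.range j, β ^ i) + 1 := by
      rw [Finset.sum_range_succ', Finset.mul_sum]
      simp [pow_succ']
    simp only [hD, this, pow_succ']
    field_simp
    ring
  refine ⟨fun j => -∑ i ∈ Finset.range j, D i, fun u hu => ?_, fun j u d hu hd => ?_,
    fun d hd => ?_⟩
  · have : D 0 = (1 - e) / U := by simp [hD, div_eq_mul_inv]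
    have h1 : 1 - e ≤ u * D 0 := by
      rw [this, ← mul_div_assoc, le_div_iff₀ hU, mul_comm u]
      exact mul_le_mul_of_nonneg_left hu he'
    simp only [Finset.sum_range_succ, Finset.sum_range_zero]
    linarith
  · have h1 : d * D j ≤ β * u * D j := mul_le_mul_of_nonneg_right hd (hD0 j)
    have h2 : 1 - e ≤ u * ((1 - e) / η) := by
      rw [← mul_div_assoc, le_div_iff₀ hη, mul_comm u]
      exact mul_le_mul_of_nonneg_left hu he'
    simp only [Finset.sum_range_succ, hDs]
    linarith
  · have h1 : d * D m ≤ d₀ * D m := mul_le_mul_of_nonneg_right hd (hD0 m)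
    simp only [Finset.sum_range_succ]
    linarith

/-- The rates of moving up: `A * g` at the bottom, `f` in between, `0` at the top. -/
def upRate (m : ℕ) (A : ℝ) (f g : X → ℝ) (s : ℕ) (y : X) : ℝ :=
  if s = 0 then A * g y else if s = m + 1 then 0 else f y

/-- The rates of moving down: `B * g` at the top, `f` in between, `0` at the bottom. -/
def downRate (m : ℕ) (B : ℝ) (f g : X → ℝ) (s : ℕ) (y : X) : ℝ :=
  if s = 0 then 0 else if s = m + 1 then B * g y else f y

/-- The verification of the birth-death machine. The parameters `a₁, b₁, β₁, η₁` and
`a₀, b₀, β₀, η₀` control the rates under the hypotheses `1` and `0`. The potentials for the two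
hypotheses are mirror images. -/
lemma minimaxRisk_le_of_rates {P : Fin 2 → Set (X → ℝ)} (hP : ∀ h, P h ⊆ stdSimplex ℝ X)
    {m : ℕ} (r₀ : Fin (m + 2)) {f g : (X → ℝ) × (X → ℝ)} (hf : f ∈ weights X)
    (hg : g ∈ weights X) {A B : ℝ} (hA0 : 0 < A) (hA1 : A ≤ 1) (hB0 : 0 < B) (hB1 : B ≤ 1)
    {e a₁ b₁ β₁ η₁ a₀ b₀ β₀ η₀ : ℝ} (he1 : e ≤ 1)
    (ha₁ : 0 < a₁) (hβ₁ : 0 ≤ β₁) (hη₁ : 0 < η₁) (ha₀ : 0 < a₀) (hβ₀ : 0 ≤ β₀) (hη₀ : 0 < η₀)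
    (h₁ : ∀ q ∈ P 1, a₁ ≤ expect q g.1 ∧ expect q g.2 ≤ b₁ ∧ η₁ ≤ expect q f.1 ∧
      expect q f.2 ≤ β₁ * expect q f.1)
    (h₀ : ∀ p ∈ P 0, a₀ ≤ expect p g.2 ∧ expect p g.1 ≤ b₀ ∧ η₀ ≤ expect p f.2 ∧
      expect p f.1 ≤ β₀ * expect p f.2)
    (hc₁ : B * b₁ * ((1 - e) * (β₁ ^ m / (A * a₁) + (∑ i ∈ Finset.range m, β₁ ^ i) / η₁)) ≤ e)
    (hc₀ : A * b₀ * ((1 - e) * (β₀ ^ m / (B * a₀) + (∑ i ∈ Finset.range m, β₀ ^ i) / η₀)) ≤ e) :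
    minimaxRisk P (m + 2) r₀ ≤ ENNReal.ofReal e := by
  have hu : ∀ s y, 0 ≤ upRate m A f.1 g.1 s y := fun s y => by
    unfold upRate
    split_ifs
    exacts [mul_nonneg hA0.le (hg y).1, le_rfl, (hf y).1]
  have hd : ∀ s y, 0 ≤ downRate m B f.2 g.2 s y := fun s y => by
    unfold downRate
    split_ifs
    exacts [le_rfl, mul_nonneg hB0.le (hg y).2.1, (hf y).2.1]
  have hud : ∀ s y, upRate m A f.1 g.1 s y + downRate m B f.2 g.2 s y ≤ 1 := fun s y => by
    obtain ⟨hg1, hg2, hg3⟩ := hg y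
    unfold upRate downRate
    split_ifs
    · have := mul_le_of_le_one_left hg1 hA1
      linarith
    · have := mul_le_of_le_one_left hg2 hB1
      linarith
    · exact (hf y).2.2
  refine iInf_le_of_le (walk m _ _ hu hd hud) (iSup_le fun A' => iSup_le fun h => ?_)
  have hu0 : ∀ p, expect p (upRate m A f.1 g.1 0) = A * expect p g.1 := fun p => by
    rw [← expect_const_mul]
    exact congrArg (expect p) (funext fun y => by simp [upRate])
  have hum : ∀ p, expect p (upRate m A f.1 g.1 (m + 1)) = 0 := fun p => by
    simp [upRate, expect]
  have huj : ∀ p j, j < m → expect p (upRate m A f.1 g.1 (j + 1)) = expect p f.1 :=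
    fun p j hj => by
      have : j ≠ m := hj.ne
      simp [upRate, expect, this]
  have hd0 : ∀ p, expect p (downRate m B f.2 g.2 0) = 0 := fun p => by
    simp [downRate, expect]
  have hdm : ∀ p, expect p (downRate m B f.2 g.2 (m + 1)) = B * expect p g.2 := fun p => by
    rw [← expect_const_mul]
    exact congrArg (expect p) (funext fun y => by simp [downRate])
  have hdj : ∀ p j, j < m → expect p (downRate m B f.2 g.2 (j + 1)) = expect p f.2 :=
    fun p j hj => by
      have : j ≠ m := hj.ne
      simp [downRate, expect, this]
  have hcases : ∀ s : Fin (m + 2), (s : ℕ) = 0 ∨ (s : ℕ) = m + 1 ∨ ∃ j, j < m ∧ (s : ℕ) = j + 1 :=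
    fun s => by
      have := s.isLt
      rcases Nat.eq_zero_or_pos (s : ℕ) with h | h
      · exact Or.inl h
      · by_cases h' : (s : ℕ) = m + 1
        · exact Or.inr (Or.inl h')
        · exact Or.inr (Or.inr ⟨s - 1, by omega, by omega⟩)
  have hcost : ∀ (s : Fin (m + 2)) (h : Fin 2),
      (if (walk m _ _ hu hd hud).decision s ≠ h then (1 : ℝ) else 0) ≤ 1 := fun s h => by
    split_ifs <;> norm_num
  rcases Fin.exists_fin_two.1 ⟨h, rfl⟩ with rfl | rfl
  · obtain ⟨V, hV0, hVj, hVm⟩ := exists_potential m (mul_pos hB0 ha₀) hβ₀ hη₀ he1 hc₀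
    refine limsup_avgErr_le (hP 0) _ r₀ _ 0 (V := fun s => V (m + 1 - s)) fun s p hp => ?_
    rw [stepExp_walk (hP 0 hp) s fun j => V (m + 1 - j)]
    obtain ⟨k1, k2, k3, k4⟩ := h₀ p hp
    have hcs := hcost s 0
    rcases hcases s with hs | hs | ⟨j, hj, hs⟩
    · have hs' : s = 0 := Fin.ext hs
      have hdec : (walk m _ _ hu hd hud).decision s = 0 := by simp [walk, hs']
      have h3 := hVm (A * expect p g.1) (mul_le_mul_of_nonneg_left k2 hA0.le)
      rw [if_neg (by simp [hdec]), hs, hu0, hd0]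
      simp only [zero_add, Nat.sub_zero, zero_mul, add_zero, sub_zero,
        min_eq_left (Nat.le_add_left 1 m), Nat.add_sub_cancel]
      linarith
    · have h3 := hV0 (B * expect p g.2) (mul_le_mul_of_nonneg_left k1 hB0.le)
      rw [hs, hum, hdm]
      simp only [Nat.sub_self, Nat.add_sub_cancel, zero_mul, add_zero, Nat.add_sub_cancel_left]
      linarith
    · obtain ⟨i, rfl⟩ : ∃ i, m = j + i + 1 := ⟨m - j - 1, by omega⟩
      have h3 := hVj i (expect p f.2) (expect p f.1) k3 k4
      rw [hs, huj p j hj, hdj p j hj, min_eq_left (by omega),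
        show j + i + 1 + 1 - (j + 1 + 1) = i by omega, show j + i + 1 + 1 - (j + 1) = i + 1 by omega,
        show j + i + 1 + 1 - (j + 1 - 1) = i + 2 by omega]
      linarith
  · obtain ⟨V, hV0, hVj, hVm⟩ := exists_potential m (mul_pos hA0 ha₁) hβ₁ hη₁ he1 hc₁
    refine limsup_avgErr_le (hP 1) _ r₀ _ 1 (V := fun s => V s) fun s q hq => ?_
    rw [stepExp_walk (hP 1 hq) s V]
    obtain ⟨k1, k2, k3, k4⟩ := h₁ q hq
    have hcs := hcost s 1
    rcases hcases s with hs | hs | ⟨j, hj, hs⟩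
    · have h3 := hV0 (A * expect q g.1) (mul_le_mul_of_nonneg_left k1 hA0.le)
      rw [hs, hu0, hd0]
      simp only [zero_add, zero_mul, add_zero, min_eq_left (Nat.le_add_left 1 m)]
      linarith
    · have hs' : s ≠ 0 := fun h0 => by simp [h0] at hs
      have hdec : (walk m _ _ hu hd hud).decision s = 1 := by simp [walk, hs']
      have h3 := hVm (B * expect q g.2) (mul_le_mul_of_nonneg_left k2 hB0.le)
      rw [if_neg (by simp [hdec]), hs, hum, hdm]
      simp only [Nat.add_sub_cancel, zero_mul, add_zero, sub_zero]
      linarith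
    · have h3 := hVj j (expect q f.1) (expect q f.2) k3 k4
      rw [hs, huj q j hj, hdj q j hj, min_eq_left (by omega), Nat.add_sub_cancel]
      linarith

/-! ### Choice of the rates -/

lemma eventually_mul_lt_nhdsGT_zero (c : ℝ) {d : ℝ} (hd : 0 < d) :
    ∀ᶠ δ in nhdsWithin (0 : ℝ) (Set.Ioi 0), δ * c < d := by
  have h : Tendsto (fun δ : ℝ => δ * c) (nhdsWithin 0 (Set.Ioi 0)) (nhds (0 * c)) :=
    (tendsto_id.mul_const c).mono_left nhdsWithin_le_nhds
  rw [zero_mul] at h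
  exact h.eventually_lt_const hd

/-- Balancing the two error probabilities: two costs with product below `z ^ 2` are both brought
below `z` by a suitable ratio `k` of the rates at the two ends, and slow rates at the ends make the
contribution of the states in between negligible. -/
lemma exists_rates {κ₁ κ₀ z : ℝ} (hκ₁ : 0 ≤ κ₁) (hκ₀ : 0 ≤ κ₀) (hz : 0 < z)
    (h : κ₁ * κ₀ < z ^ 2) (K₁ K₀ : ℝ) : ∃ A B : ℝ, 0 < A ∧ A ≤ 1 ∧ 0 < B ∧ B ≤ 1 ∧
      B / A * κ₁ + B * K₁ ≤ z ∧ A / B * κ₀ + A * K₀ ≤ z := by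
  obtain ⟨k, hk1, hk0⟩ : ∃ k, κ₁ / z < k ∧ k * κ₀ < z := by
    rcases hκ₀.eq_or_lt with h0 | h0
    · exact ⟨κ₁ / z + 1, by linarith, by rw [← h0, mul_zero]; exact hz⟩
    · obtain ⟨k, h1, h2⟩ := exists_between (show κ₁ / z < z / κ₀ by
        rw [div_lt_div_iff₀ hz h0, ← pow_two]
        exact h)
      exact ⟨k, h1, (lt_div_iff₀ h0).1 h2⟩
  have hk : 0 < k := (div_nonneg hκ₁ hz.le).trans_lt hk1
  have hk1' : k⁻¹ * κ₁ < z := by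
    rw [inv_mul_lt_iff₀ hk]
    exact (div_lt_iff₀ hz).1 hk1
  obtain ⟨δ, h1, h2, h3, h4, hδ⟩ := ((eventually_mul_lt_nhdsGT_zero K₁ (sub_pos.2 hk1')).and
    ((eventually_mul_lt_nhdsGT_zero (k * K₀) (sub_pos.2 hk0)).and
    ((eventually_mul_lt_nhdsGT_zero k one_pos).and
    ((eventually_mul_lt_nhdsGT_zero 1 one_pos).and self_mem_nhdsWithin)))).exists
  have hδ0 : 0 < δ := hδ
  refine ⟨δ * k, δ, by positivity, h3.le, hδ0, by linarith, ?_, ?_⟩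
  · have : δ / (δ * k) = k⁻¹ := by field_simp
    rw [this]
    linarith
  · have : δ * k / δ = k := by field_simp
    rw [this]
    linarith

lemma expect_fst_nonneg {P : Fin 2 → Set (X → ℝ)} (hP : ∀ h, P h ⊆ stdSimplex ℝ X)
    {f : (X → ℝ) × (X → ℝ)} (hf : f ∈ weights X) {h : Fin 2} {p : X → ℝ} (hp : p ∈ P h) :
    0 ≤ expect p f.1 := expect_nonneg (hP h hp) fun x => (hf x).1

lemma expect_snd_nonneg {P : Fin 2 → Set (X → ℝ)} (hP : ∀ h, P h ⊆ stdSimplex ℝ X)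
    {f : (X → ℝ) × (X → ℝ)} (hf : f ∈ weights X) {h : Fin 2} {p : X → ℝ} (hp : p ∈ P h) :
    0 ≤ expect p f.2 := expect_nonneg (hP h hp) fun x => (hf x).2.1

lemma exists_isMaxOn_expect_div {P : Set (X → ℝ)} (hP : P ⊆ stdSimplex ℝ X) (hne : P.Nonempty)
    (hcl : IsClosed P) {u v : X → ℝ} (hv : ∀ q ∈ P, 0 < expect q v) :
    ∃ q ∈ P, ∀ q' ∈ P, expect q' u / expect q' v ≤ expect q u / expect q v :=
  ((isCompact_stdSimplex ℝ X).of_isClosed_subset hcl hP).exists_isMaxOn hne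
    ((continuous_expect u).continuousOn.div (continuous_expect v).continuousOn
      fun q hq => (hv q hq).ne')

lemma exists_isMinOn_expect {P : Set (X → ℝ)} (hP : P ⊆ stdSimplex ℝ X) (hne : P.Nonempty)
    (hcl : IsClosed P) (f : X → ℝ) : ∃ q ∈ P, ∀ q' ∈ P, expect q f ≤ expect q' f :=
  ((isCompact_stdSimplex ℝ X).of_isClosed_subset hcl hP).exists_isMinOn hne
    (continuous_expect f).continuousOn

/-- The upper bound, given weights `f` for `γ` and `g` for `C` of values at least `a` and `c`. -/
lemma minimaxRisk_le_of_weights {P : Fin 2 → Set (X → ℝ)} (hP : ∀ h, P h ⊆ stdSimplex ℝ X)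
    (hne : ∀ h, (P h).Nonempty) (hcl : ∀ h, IsClosed (P h)) {m : ℕ} (r₀ : Fin (m + 2))
    {f g : (X → ℝ) × (X → ℝ)} (hf : f ∈ weights X) (hg : g ∈ weights X) {a c w : ℝ}
    (ha : 0 < a) (hc : 0 < c) (hw : 0 < w) (hwac : w ^ 2 < c * a ^ m)
    (hfa : ∀ p ∈ P 0, ∀ q ∈ P 1, 0 < expect q f.1 * expect p f.2 ∧
      a * (expect q f.2 * expect p f.1) ≤ expect q f.1 * expect p f.2)
    (hgc : ∀ p ∈ P 0, ∀ p' ∈ P 0, ∀ q ∈ P 1, ∀ q' ∈ P 1, 0 < expect q g.1 * expect p g.2 ∧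
      c * (expect q' g.2 * expect p' g.1) ≤ expect q g.1 * expect p g.2) :
    minimaxRisk P (m + 2) r₀ ≤ ENNReal.ofReal (1 / (1 + w)) := by
  obtain ⟨p₀, hp₀⟩ := hne 0
  obtain ⟨q₀, hq₀⟩ := hne 1
  have hf1 : ∀ q ∈ P 1, 0 < expect q f.1 := fun q hq =>
    pos_of_mul_pos_left (hfa p₀ hp₀ q hq).1 (expect_snd_nonneg hP hf hp₀)
  have hf2 : ∀ p ∈ P 0, 0 < expect p f.2 := fun p hp =>
    pos_of_mul_pos_right (hfa p hp q₀ hq₀).1 (expect_fst_nonneg hP hf hq₀)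
  have hg1 : ∀ q ∈ P 1, 0 < expect q g.1 := fun q hq =>
    pos_of_mul_pos_left (hgc p₀ hp₀ p₀ hp₀ q hq q hq).1 (expect_snd_nonneg hP hg hp₀)
  have hg2 : ∀ p ∈ P 0, 0 < expect p g.2 := fun p hp =>
    pos_of_mul_pos_right (hgc p hp p hp q₀ hq₀ q₀ hq₀).1 (expect_fst_nonneg hP hg hq₀)
  obtain ⟨q₁, hq₁, hβ₁⟩ := exists_isMaxOn_expect_div (hP 1) (hne 1) (hcl 1) (u := f.2) hf1
  obtain ⟨p₁, hp₁, hβ₀⟩ := exists_isMaxOn_expect_div (hP 0) (hne 0) (hcl 0) (u := f.1) hf2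
  obtain ⟨q₂, hq₂, hη₁⟩ := exists_isMinOn_expect (hP 1) (hne 1) (hcl 1) f.1
  obtain ⟨p₂, hp₂, hη₀⟩ := exists_isMinOn_expect (hP 0) (hne 0) (hcl 0) f.2
  obtain ⟨q₃, hq₃, ha₁⟩ := exists_isMinOn_expect (hP 1) (hne 1) (hcl 1) g.1
  obtain ⟨p₃, hp₃, ha₀⟩ := exists_isMinOn_expect (hP 0) (hne 0) (hcl 0) g.2
  obtain ⟨q₄, hq₄, hb₁⟩ := exists_isMaxOn_expect (hP 1) (hne 1) (hcl 1) g.2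
  obtain ⟨p₄, hp₄, hb₀⟩ := exists_isMaxOn_expect (hP 0) (hne 0) (hcl 0) g.1
  set β₁ := expect q₁ f.2 / expect q₁ f.1 with hβ₁def
  set β₀ := expect p₁ f.1 / expect p₁ f.2 with hβ₀def
  have hβ₁0 : 0 ≤ β₁ := div_nonneg (expect_snd_nonneg hP hf hq₁) (expect_fst_nonneg hP hf hq₁)
  have hβ₀0 : 0 ≤ β₀ := div_nonneg (expect_fst_nonneg hP hf hp₁) (expect_snd_nonneg hP hf hp₁)
  have hββ : a * (β₁ * β₀) ≤ 1 := by
    have := (hfa p₁ hp₁ q₁ hq₁).2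
    rw [hβ₁def, hβ₀def, div_mul_div_comm, ← mul_div_assoc,
      div_le_one (mul_pos (hf1 _ hq₁) (hf2 _ hp₁))]
    exact this
  set a₁ := expect q₃ g.1
  set a₀ := expect p₃ g.2
  set b₁ := expect q₄ g.2
  set b₀ := expect p₄ g.1
  have ha₁0 : 0 < a₁ := hg1 _ hq₃
  have ha₀0 : 0 < a₀ := hg2 _ hp₃
  have hb₁0 : 0 ≤ b₁ := expect_snd_nonneg hP hg hq₄
  have hb₀0 : 0 ≤ b₀ := expect_fst_nonneg hP hg hp₄
  have hbb : c * (b₁ * b₀) ≤ a₁ * a₀ := (hgc p₃ hp₃ p₄ hp₄ q₃ hq₃ q₄ hq₄).2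
  set κ₁ := b₁ * β₁ ^ m / a₁ with hκ₁
  set κ₀ := b₀ * β₀ ^ m / a₀ with hκ₀
  have hκ : κ₁ * κ₀ < w⁻¹ ^ 2 := by
    have h1 : (c * a ^ m) * (κ₁ * κ₀) ≤ 1 := by
      have h2 : (c * a ^ m) * (κ₁ * κ₀) =
          (c * (b₁ * b₀)) / (a₁ * a₀) * (a * (β₁ * β₀)) ^ m := by
        rw [hκ₁, hκ₀]
        simp only [mul_pow]
        field_simp
      rw [h2]
      exact mul_le_one₀ ((div_le_one (by positivity)).2 hbb) (by positivity)
        (pow_le_one₀ (by positivity) hββ)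
    have h3 : κ₁ * κ₀ ≤ (c * a ^ m)⁻¹ := by
      rw [← one_div, le_div_iff₀ (by positivity), mul_comm]
      exact h1
    rw [inv_pow]
    exact h3.trans_lt ((inv_lt_inv₀ (by positivity) (by positivity)).2 hwac)
  obtain ⟨A, B, hA0, hA1, hB0, hB1, hz₁, hz₀⟩ := exists_rates (by positivity : 0 ≤ κ₁)
    (by positivity : 0 ≤ κ₀) (inv_pos.2 hw) hκ
    (b₁ * ((∑ i ∈ Finset.range m, β₁ ^ i) / expect q₂ f.1))
    (b₀ * ((∑ i ∈ Finset.range m, β₀ ^ i) / expect p₂ f.2))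
  have he : 1 - 1 / (1 + w) = w * (1 / (1 + w)) := by field_simp; ring
  have he0 : 0 < 1 / (1 + w) := by positivity
  -- a bound by the odds `w⁻¹` is a bound by the error probability `1 / (1 + w)`
  have hodds : ∀ {t : ℝ}, t ≤ w⁻¹ → (1 - 1 / (1 + w)) * t ≤ 1 / (1 + w) := fun ht => by
    rw [he]
    calc w * (1 / (1 + w)) * _ ≤ w * (1 / (1 + w)) * w⁻¹ := by gcongr
      _ = 1 / (1 + w) := by field_simp
  refine minimaxRisk_le_of_rates hP r₀ hf hg hA0 hA1 hB0 hB1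
    ((div_le_one (by positivity)).2 (by linarith)) ha₁0 hβ₁0 (hf1 _ hq₂) ha₀0 hβ₀0 (hf2 _ hp₂)
    (b₁ := b₁) (b₀ := b₀)
    (fun q hq => ⟨ha₁ q hq, hb₁ q hq, hη₁ q hq, (div_le_iff₀ (hf1 q hq)).1 (hβ₁ q hq)⟩)
    (fun p hp => ⟨ha₀ p hp, hb₀ p hp, hη₀ p hp, (div_le_iff₀ (hf2 p hp)).1 (hβ₀ p hp)⟩) ?_ ?_
  · refine le_of_eq_of_le ?_ (hodds hz₁)
    rw [hκ₁]
    field_simp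
  · refine le_of_eq_of_le ?_ (hodds hz₀)
    rw [hκ₀]
    field_simp

/-! ### The two bounds -/

/-- Real lower approximations of the factors of a product `C * γ ^ m` in `ℝ≥0∞`. -/
lemma exists_ofReal_lt_of_lt_mul_pow {d C γ : ℝ≥0∞} {m : ℕ} (h : d < C * γ ^ m) (hγ : 0 < γ) :
    ∃ c a : ℝ, 0 < c ∧ 0 < a ∧ ENNReal.ofReal c < C ∧ ENNReal.ofReal a < γ ∧
      d < ENNReal.ofReal (c * a ^ m) := by
  obtain ⟨c', hc', x, hx, hd⟩ : ∃ c' < C, ∃ x < γ ^ m, d < c' * x := by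
    by_contra! hcon
    exact absurd (ENNReal.mul_le_of_forall_lt hcon) (not_le.2 h)
  have : (nhdsWithin γ (Set.Iio γ)).NeBot := nhdsLT_neBot_of_exists_lt ⟨0, hγ⟩
  obtain ⟨a', h1, h2, h3⟩ := ((((ENNReal.continuous_pow m).tendsto γ).mono_left
    nhdsWithin_le_nhds).eventually_const_lt hx |>.and
    ((eventually_nhdsWithin_of_eventually_nhds (lt_mem_nhds hγ)).and
      (self_mem_nhdsWithin (s := Set.Iio γ)))).exists
  have ha : a' ≠ ∞ := ne_top_of_lt h3
  have hc : c' ≠ ∞ := ne_top_of_lt hc'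
  have hc0 : c' ≠ 0 := fun h0 => by simp [h0] at hd
  refine ⟨c'.toReal, a'.toReal, ENNReal.toReal_pos hc0 hc, ENNReal.toReal_pos h2.ne' ha, ?_, ?_, ?_⟩
  · rwa [ENNReal.ofReal_toReal hc]
  · rwa [ENNReal.ofReal_toReal ha]
  · rw [ENNReal.ofReal_mul ENNReal.toReal_nonneg, ENNReal.ofReal_pow ENNReal.toReal_nonneg,
      ENNReal.ofReal_toReal hc, ENNReal.ofReal_toReal ha]
    exact hd.trans_le (by gcongr)

lemma one_le_cConst {P : Fin 2 → Set (X → ℝ)} (hP : ∀ h, P h ⊆ stdSimplex ℝ X) :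
    1 ≤ cConst P := by
  have hw : ((fun _ => 1 / 2, fun _ => 1 / 2) : (X → ℝ) × (X → ℝ)) ∈ weights X :=
    fun x => by norm_num
  refine le_iSup₂_of_le _ hw (le_iInf₂ fun p hp => le_iInf₂ fun p' hp' => le_iInf₂ fun q hq =>
    le_iInf₂ fun q' hq' => ?_)
  unfold ratio
  rw [← ENNReal.ofReal_one]
  simp only [expect_const (hP 0 hp), expect_const (hP 0 hp'), expect_const (hP 1 hq),
    expect_const (hP 1 hq')]
  rw [le_ofReal_div_ofReal_iff one_pos (by norm_num)]
  norm_num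

lemma minimaxRisk_le {P : Fin 2 → Set (X → ℝ)} (hP : ∀ h, P h ⊆ stdSimplex ℝ X)
    (hne : ∀ h, (P h).Nonempty) (hcl : ∀ h, IsClosed (P h)) {m : ℕ} (r₀ : Fin (m + 2)) :
    minimaxRisk P (m + 2) r₀ ≤
      1 / (1 + (cConst P * gammaConst P ^ m) ^ (1 / 2 : ℝ)) := by
  set Z := (cConst P * gammaConst P ^ m) ^ (1 / 2 : ℝ) with hZ
  have key : ∀ y < Z, 1 + y ≤ (minimaxRisk P (m + 2) r₀)⁻¹ := by
    intro y hy
    obtain ⟨w', hyw, hw'⟩ := exists_between hy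
    have hwtop : w' ≠ ∞ := ne_top_of_lt hw'
    set w := w'.toReal with hwdef
    have hw0 : 0 < w := ENNReal.toReal_pos (zero_le.trans_lt hyw).ne' hwtop
    have hww : ENNReal.ofReal w = w' := ENNReal.ofReal_toReal hwtop
    have h1 : w' ^ 2 < cConst P * gammaConst P ^ m := by
      rw [hZ, one_div, ENNReal.lt_rpow_inv_iff two_pos, ENNReal.rpow_two] at hw'
      exact hw'
    obtain ⟨c, a, hc, ha, hcC, haγ, hlt⟩ := exists_ofReal_lt_of_lt_mul_pow h1
      (zero_lt_one.trans_le (one_le_gammaConst hP))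
    rw [← hww, ← ENNReal.ofReal_pow hw0.le,
      ENNReal.ofReal_lt_ofReal_iff (by positivity)] at hlt
    simp only [cConst, gammaConst, lt_iSup_iff] at hcC haγ
    obtain ⟨g, hg, hgc⟩ := hcC
    obtain ⟨f, hf, hfa⟩ := haγ
    have h2 := minimaxRisk_le_of_weights hP hne hcl r₀ hf hg ha hc hw0 hlt
      (fun p hp q hq => (le_ofReal_div_ofReal_iff ha (mul_nonneg (expect_snd_nonneg hP hf hq) (expect_fst_nonneg hP hf hp))).1
        (hfa.le.trans (iInf₂_le_of_le p hp (iInf₂_le q hq))))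
      (fun p hp p' hp' q hq q' hq' =>
        (le_ofReal_div_ofReal_iff hc (mul_nonneg (expect_snd_nonneg hP hg hq') (expect_fst_nonneg hP hg hp'))).1
        (hgc.le.trans (iInf₂_le_of_le p hp (iInf₂_le_of_le p' hp'
          (iInf₂_le_of_le q hq (iInf₂_le q' hq'))))))
    rw [one_div, ENNReal.ofReal_inv_of_pos (by positivity), ENNReal.ofReal_add zero_le_one hw0.le,
      ENNReal.ofReal_one, hww] at h2
    exact (add_le_add_right hyw.le 1).trans (ENNReal.le_inv_iff_le_inv.1 h2)
  rw [one_div, ENNReal.le_inv_iff_le_inv]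
  have hZ0 : 0 < Z := by
    refine ENNReal.rpow_pos_of_nonneg (zero_lt_one.trans_le ?_) (by norm_num)
    exact one_le_mul (one_le_cConst hP) (one_le_pow₀ (one_le_gammaConst hP))
  have hone : 1 ≤ (minimaxRisk P (m + 2) r₀)⁻¹ := by simpa using key 0 hZ0
  calc 1 + Z ≤ 1 + ((minimaxRisk P (m + 2) r₀)⁻¹ - 1) := by
        refine add_le_add_right (le_of_forall_lt_imp_le_of_dense fun y hy => ?_) 1
        exact ENNReal.le_sub_of_add_le_left ENNReal.one_ne_top (key y hy)
    _ = _ := add_tsub_cancel_of_le hone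

/-- A machine with a single state always gives the same output, hence always errs under one of the
hypotheses. -/
lemma one_le_minimaxRisk_one {P : Fin 2 → Set (X → ℝ)} (hP : ∀ h, P h ⊆ stdSimplex ℝ X)
    (hne : ∀ h, (P h).Nonempty) (r₀ : Fin 1) : 1 ≤ minimaxRisk P 1 r₀ := by
  choose p hp using hne
  refine le_iInf fun D => ?_
  refine le_iSup_of_le (fun h => iidStrategy 1 ⟨p h, hp h⟩) ?_
  obtain ⟨h, hh⟩ : ∃ h, D.decision r₀ ≠ h := ⟨1 - D.decision r₀, by omega⟩
  refine le_iSup_of_le h ?_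
  have hone : ∀ n, errProb D r₀ (iidStrategy 1 ⟨p h, hp h⟩) h n = 1 := fun n => by
    rw [errProb_eq_stateExp]
    conv_rhs => rw [← stateExp_const (hP h) D r₀ (iidStrategy 1 ⟨p h, hp h⟩) n 1]
    congr 1
    funext s
    rw [Subsingleton.elim s r₀, if_pos hh]
  refine le_limsup_of_frequently_le (Eventually.frequently ?_)
  filter_upwards [eventually_gt_atTop 0] with n hn
  have hn' : (n : ℝ) ≠ 0 := by exact_mod_cast hn.ne'
  simp [avgErr, hone, hn']

lemma le_minimaxRisk {P : Fin 2 → Set (X → ℝ)} (hP : ∀ h, P h ⊆ stdSimplex ℝ X)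
    (hne : ∀ h, (P h).Nonempty) (hcl : ∀ h, IsClosed (P h)) (hcv : ∀ h, Convex ℝ (P h))
    (r₀ : Fin S) :
    1 / (1 + (gammaConst P ^ (S - 1)) ^ (1 / 2 : ℝ)) ≤ minimaxRisk P S r₀ := by
  choose p hp using hne
  rcases eq_or_ne (gammaConst P) ∞ with htop | htop
  · obtain rfl | hS : S = 1 ∨ 2 ≤ S := by
      have := r₀.pos
      omega
    · refine le_trans ?_ (one_le_minimaxRisk_one hP (fun h => ⟨p h, hp h⟩) r₀)
      rw [one_div, ENNReal.inv_le_one]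
      exact le_self_add
    · rw [htop, ENNReal.top_pow (by omega), ENNReal.top_rpow_of_pos (by norm_num), add_top,
        ENNReal.div_top]
      exact zero_le
  · set G := (gammaConst P).toReal with hGdef
    have hG : gammaConst P = ENNReal.ofReal G := (ENNReal.ofReal_toReal htop).symm
    have hG1 : 1 ≤ G := by
      have := one_le_gammaConst hP
      rwa [hG, ENNReal.one_le_ofReal] at this
    obtain ⟨p, hp, q, hq, c, hpq, hqp⟩ :=
      exists_comparable hP (fun h => ⟨p h, hp h⟩) hcl hcv hG hG1
    have hG0 : 0 ≤ G ^ (S - 1) := by positivity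
    have hb : 1 / (1 + (gammaConst P ^ (S - 1)) ^ (1 / 2 : ℝ)) =
        ENNReal.ofReal (1 / (1 + √(G ^ (S - 1)))) := by
      rw [hG, ← ENNReal.ofReal_pow (by linarith), ENNReal.ofReal_rpow_of_nonneg hG0 (by norm_num),
        ← Real.sqrt_eq_rpow, one_div, one_div, ENNReal.ofReal_inv_of_pos (by positivity),
        ENNReal.ofReal_add zero_le_one (Real.sqrt_nonneg _), ENNReal.ofReal_one]
    rw [hb]
    refine le_iInf fun D => ?_
    exact (le_asympErr_of_comparable hP D r₀
      (Fin.cons ⟨p, hp⟩ (Fin.cons ⟨q, hq⟩ finZeroElim) : (h : Fin 2) → P h)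
      (by linarith) hpq hqp).trans (le_iSup (asympErr D r₀) _)

end AdvHT

theorem theorem1 {X : Type*} [Fintype X] (P : Fin 2 → Set (X → ℝ))
    (hP_dist : ∀ h, P h ⊆ stdSimplex ℝ X) (hP_nonempty : ∀ h, (P h).Nonempty)
    (hP_closed : ∀ h, IsClosed (P h)) (hP_convex : ∀ h, Convex ℝ (P h))
    (S : ℕ) (r₀ : Fin S) :
    1 / (1 + (AdvHT.gammaConst P ^ (S - 1)) ^ (1 / 2 : ℝ)) ≤ AdvHT.minimaxRisk P S r₀ ∧
    (3 ≤ S → AdvHT.minimaxRisk P S r₀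
      ≤ 1 / (1 + (AdvHT.cConst P * AdvHT.gammaConst P ^ (S - 2)) ^ (1 / 2 : ℝ))) := by
  refine ⟨AdvHT.le_minimaxRisk hP_dist hP_nonempty hP_closed hP_convex r₀, fun hS => ?_⟩
  obtain ⟨m, rfl⟩ : ∃ m, S = m + 2 := ⟨S - 2, by omega⟩
  exact AdvHT.minimaxRisk_le hP_dist hP_nonempty hP_closed r₀
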